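/- Conventions. For integrable $f$ on $\mathbb R$ let $\widetilde f(\xi)=\int_{\mathbb R}e^{ix\xi}f(x)\,dx$; an operator has symbol $m$ if it multiplies $\widetilde f(\xi)$ by $m(\xi)$ ($\xi\neq 0$). Results of the operators below are integrable continuous functions. For $\alpha\in(1,2]$ and $|\theta|\le 2-\alpha$ put $\psi_{\alpha,\theta}(\xi)=|\xi|^{\alpha}e^{i\,\mathrm{sign}(\xi)\theta\pi/2}$. The Riesz–Feller derivative $\mathcal D_x^{\alpha,\theta}$ has symbol $-\psi_{\alpha,\theta}(\xi)$; the fractional shift operator is $\mathcal O_{1,x}^{\alpha,\theta}=\sum_{n\ge 0}\frac1{n!}(\mathcal D_x^{\alpha,\theta})^n$, the series being summed on the side of Fourier transforms, so that its symbol is $e^{-\psi_{\alpha,\theta}(\xi)}$; for $0<\nu<1$, $|\gamma|\le\nu$, the Feller integral $I^{\nu}_{\gamma}$ has symbol $|\xi|^{-\nu}e^{-i\pi\gamma\,\mathrm{sign}(\xi)/2}$. The stable process $\mathcal S_\alpha^\theta$ has $\mathcal S_\alpha^\theta(0)=0$ and independent stationary increments, with $\mathbb E e^{i\xi \mathcal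 S_\alpha^\theta(t)}=e^{-t\psi_{\alpha,\theta}(\xi)}$; its transition density is $p_\alpha^\theta(x,t)$. Theorem. Let $a\ge0$, $\lambda>0$, let $B$ be a linear birth (Yule–Furry) process with one progenitor and rate $\lambda$ ($B(0)=1$, jumps $k\to k+1$ at rate $\lambda k$), independent of $\mathcal S_\alpha^\theta$, and let $\mathcal Y_\alpha^\theta(t)=\mathcal S_\alpha^\theta(at+B(t))$, $t\ge 0$. (i) Let $\alpha\in(1,2)$ and $\theta=2-\alpha$. Then $\mathcal Y_\alpha^\theta(t)$ has, for each $t\ge0$, a continuous density $u(\cdot,t)$, the terms below are well defined, and for all $x\in\mathbb R$, $t\ge0$ (with the right derivative at $t=0$) $$\partial_t u(x,t)=a\left[\mathcal D_x^{\alpha,\theta}+\lambda t\,(I-\mathcal O_{1,x}^{\alpha,\theta})\right]u(x,t)+\frac{\lambda}{\alpha}\,(I-\mathcal O_{1,x}^{\alpha,\theta})\,I^{\alpha-1}_{1-\alpha}[x\,u(x,t)],\qquad u(x,0)=p_\alpha^\theta(x,1).$$ Moreover, if $(1+at)\cos(\pi\theta/2)\ge1$, then both series $\sum_n\frac1{n!}(\mathcal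 D_x^{\alpha,\theta})^n$ (applied to $u(\cdot,t)$ and to $I^{\alpha-1}_{1-\alpha}[x\,u(x,t)]$) converge uniformly in $x$ to the respective values of $\mathcal O_{1,x}^{\alpha,\theta}$. (ii) Let $\alpha=2$ and $\theta=0$. Then $\mathcal Y_2^0(t)$ has, for each $t\ge0$, a continuous density $u(\cdot,t)$, and for all $x\in\mathbb R$, $t\ge0$ (with the right derivative at $t=0$) $$\partial_t u(x,t)=a\left[\partial_x^2+\lambda t\,(I-e^{\partial_x^2})\right]u(x,t)+\frac{\lambda}{2}\,(I-e^{\partial_x^2})\int_{-\infty}^{x}z\,u(z,t)\,dz,\qquad u(x,0)=\frac{1}{\sqrt{4\pi}}e^{-x^2/4},$$ where $e^{\partial_x^2}f=\sum_{n\ge0}\frac1{n!}\partial_x^{2n}f$, both series converging uniformly in $x$. -/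

import Mathlib

open MeasureTheory ProbabilityTheory Filter
open scoped NNReal ENNReal Topology

/-! ### Fourier transform and Fourier multiplier operators -/

/-- The Fourier transform `f̃(ξ) = ∫ e^{i x ξ} f(x) dx` of a real function (no `2π` in the
exponent, positive sign). -/
noncomputable def fourierPos (f : ℝ → ℝ) (ξ : ℝ) : ℂ :=
  ∫ x : ℝ, Complex.exp (Complex.I * ξ * x) * (f x : ℂ)

/-- `g` is the result of applying to `f` the pseudo-differential operator with symbol `m`:
both are integrable, and `g̃(ξ) = m(ξ) f̃(ξ)`. The frequency `ξ = 0`, where a symbol may be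
singular, is left out; this loses nothing, since `f̃` and `g̃` are continuous. The function `g` is
required to be continuous, so that it is determined by `f` at every point. -/
structure IsFourierMultiplier (m : ℝ → ℂ) (f g : ℝ → ℝ) : Prop where
  integrable_left : Integrable f
  integrable_right : Integrable g
  continuous_right : Continuous g
  fourier_eq : ∀ ξ : ℝ, ξ ≠ 0 → fourierPos g ξ = m ξ * fourierPos f ξ

/-- `ψ_{α,θ}(ξ) = |ξ|^α e^{i sign(ξ) θ π / 2}`. -/
noncomputable def psiSymbol (α θ ξ : ℝ) : ℂ :=
  ((|ξ| ^ α : ℝ) : ℂ) * Complex.exp (Complex.I * ((Real.sign ξ * θ * Real.pi / 2 : ℝ) : ℂ))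

/-- `g = 𝒟^{α,θ} f`, the Riesz-Feller fractional derivative: the operator with symbol
`-ψ_{α,θ}`. -/
def IsRieszFeller (α θ : ℝ) (f g : ℝ → ℝ) : Prop :=
  IsFourierMultiplier (fun ξ => -psiSymbol α θ ξ) f g

/-- `g = I_γ^ν f`, the Feller integral: the operator with symbol
`|ξ|^{-ν} e^{-i π γ sign(ξ) / 2}`. -/
def IsFellerIntegral (ν γ : ℝ) (f g : ℝ → ℝ) : Prop :=
  IsFourierMultiplier
    (fun ξ => ((|ξ| ^ (-ν) : ℝ) : ℂ) *
      Complex.exp (-(Complex.I * ((Real.pi * γ * Real.sign ξ / 2 : ℝ) : ℂ)))) f g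

/-- `G n` is the `n`-fold iterate `𝒟^{α,θ} ⋯ 𝒟^{α,θ} f`, all of these being integrable. -/
def IsRieszFellerIterates (α θ : ℝ) (f : ℝ → ℝ) (G : ℕ → ℝ → ℝ) : Prop :=
  G 0 = f ∧ ∀ n, IsRieszFeller α θ (G n) (G (n + 1))

/-- `g = 𝒪_c^{α,θ} f`, the fractional shift (exponential) operator
`∑ n, (c ^ n / n!) 𝒟^{α,θ} ⋯ 𝒟^{α,θ} f` (`n` factors in the `n`-th term), the series being summed
on the side of the Fourier transforms. In other words `g̃(ξ) = e^{-c ψ_{α,θ}(ξ)} f̃(ξ)`. -/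
def IsFractionalShift (α θ c : ℝ) (f g : ℝ → ℝ) : Prop :=
  ∃ G : ℕ → ℝ → ℝ, IsRieszFellerIterates α θ f G ∧ Integrable g ∧ Continuous g ∧
    ∀ ξ : ℝ, HasSum (fun n : ℕ => ((c ^ n / (n.factorial : ℝ) : ℝ) : ℂ) * fourierPos (G n) ξ)
      (fourierPos g ξ)

/-- The series `∑ n, (c ^ n / n!) 𝒟^{α,θ} ⋯ 𝒟^{α,θ} f` converges to `g` uniformly on the line. -/
def IsUniformFractionalShift (α θ c : ℝ) (f g : ℝ → ℝ) : Prop :=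
  ∃ G : ℕ → ℝ → ℝ, IsRieszFellerIterates α θ f G ∧
    TendstoUniformly
      (fun (N : ℕ) (x : ℝ) => ∑ n ∈ Finset.range N, c ^ n / (n.factorial : ℝ) * G n x) g atTop

/-- `g = e^{∂ₓ²} f`: `f` is smooth, its derivatives of even order are integrable, and
`∑ n, (1 / n!) ∂ₓ^{2n} f` converges to `g` uniformly on the line. -/
structure IsExpSecondDeriv (f g : ℝ → ℝ) : Prop where
  smooth : ContDiff ℝ (⊤ : ℕ∞) f
  integrable : ∀ n : ℕ, Integrable (iteratedDeriv (2 * n) f)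
  tendsto : TendstoUniformly
    (fun (N : ℕ) (x : ℝ) =>
      ∑ n ∈ Finset.range N, iteratedDeriv (2 * n) f x / (n.factorial : ℝ)) g atTop

/-! ### Processes -/

/-- `f` is the (unique) continuous density of the measure `ν` on the line. -/
structure IsContinuousDensity (ν : Measure ℝ) (f : ℝ → ℝ) : Prop where
  continuous : Continuous f
  nonneg : ∀ x, 0 ≤ f x
  eq_withDensity : ν = volume.withDensity (fun x => ENNReal.ofReal (f x))

/-- The `α`-stable process `𝒮_α^θ`: it starts at `0` and has independent and stationary
increments, with `E e^{iξ (S(t) - S(s))} = e^{-(t - s) ψ_{α,θ}(ξ)}`. -/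
structure IsStableProcess {Ω : Type*} [MeasurableSpace Ω] (α θ : ℝ) (S : ℝ≥0 → Ω → ℝ)
    (μ : Measure Ω) : Prop where
  measurable : ∀ t, Measurable (S t)
  zero : ∀ᵐ ω ∂μ, S 0 ω = 0
  indep : HasIndepIncrements S μ
  charFun_increment : ∀ s t : ℝ≥0, s ≤ t → ∀ ξ : ℝ,
    charFun (μ.map (fun ω => S t ω - S s ω)) ξ
      = Complex.exp (-(((t : ℝ) - (s : ℝ) : ℝ) : ℂ) * psiSymbol α θ ξ)

/-- The linear birth (Yule-Furry) process with one progenitor and rate `rate`: it starts at `1`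
and increases by unit jumps; the successive holding times `T 0, T 1, …` are independent, and that
in the state `n + 1` is exponential with parameter `rate * (n + 1)`. The state at time `t` exceeds
`n` if and only if the first `n` births have taken place by time `t`. -/
structure IsYuleProcess {Ω : Type*} [MeasurableSpace Ω] (rate : ℝ) (B : ℝ≥0 → Ω → ℕ)
    (μ : Measure Ω) : Prop where
  measurable : ∀ t, Measurable (B t)
  holding : ∃ T : ℕ → Ω → ℝ, (∀ n, Measurable (T n)) ∧ iIndepFun T μ ∧
    (∀ n : ℕ, μ.map (T n) = expMeasure (rate * (n + 1))) ∧
    ∀ᵐ ω ∂μ, ∀ (t : ℝ≥0) (n : ℕ), n < B t ω ↔ ∑ i ∈ Finset.range n, T i ω ≤ (t : ℝ)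

/-!
Let `G_t(w) = E e^{-(a t + B(t)) w}`. The Fourier transform of the density `u(·, t)` is `G_t(ψ(ξ))`
with `ψ = ψ_{α,θ}`. As `B(t)` is geometric with parameter `q = e^{-λ t}`,

`G_t(w) = q e^{-(1 + a t) w} / (1 - (1 - q) e^{-w})`,

and a direct computation gives, for every `w` with `0 ≤ Re w`,

`∂_t G_t = a (-w G_t + λ t (1 - e^{-w}) G_t) + λ (1 - e^{-w}) ∂_w G_t`.

At `w = ψ(ξ)` this is the equation of the theorem on the side of Fourier transforms: the transform
of `x u(x, t)` is `-i ∂_ξ (G_t(ψ(ξ))) = -i ψ'(ξ) ∂_w G_t(ψ(ξ))`, and the symbol of the Feller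
integral times `ψ'(ξ)` is the constant `α i`, so that `(1/α) I[x u]` has transform `∂_w G_t(ψ(ξ))`.

The equation is brought back to the line by Fourier inversion. All symbols that occur decay faster
than any power and are differentiable with square integrable derivative, so their inverse transforms
are integrable. That `x u(x, t)` is integrable too is the first moment of the law, which is finite
because `1 - G_t(ψ(ξ)) = O(|ξ|^α)` with `1 < α`.
-/

section Fourier

open FourierTransform

theorem continuous_fourier {g : ℝ → ℂ} (hg : Integrable g) : Continuous (𝓕 g) :=
  VectorFourier.fourierIntegral_continuous Real.continuous_fourierChar
    (by exact continuous_inner) hg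

/-- Both sides agree when tested against Schwartz functions. -/
theorem ae_eq_fourier_toLp {g : ℝ → ℂ} (hg : Integrable g) (hg2 : MemLp g 2) :
    𝓕 g =ᵐ[volume] (𝓕 (hg2.toLp g) : Lp ℂ 2 (volume : Measure ℝ)) := by
  set h : Lp ℂ 2 (volume : Measure ℝ) := 𝓕 (hg2.toLp g)
  refine ae_eq_of_integral_contDiff_smul_eq (continuous_fourier hg).locallyIntegrable
    ((Lp.memLp h).locallyIntegrable (by norm_num)) fun φ φ_smooth φ_compact => ?_
  have Φ_compact : HasCompactSupport (Complex.ofRealCLM ∘ φ) := φ_compact.comp_left rfl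
  set Φ := Φ_compact.toSchwartzMap (Complex.ofRealCLM.contDiff.comp φ_smooth)
  have test_h : ∫ x, (𝓕 (Φ : ℝ → ℂ)) x • g x = ∫ x, Φ x • h x := by
    have := congrArg (fun T => T Φ)
      (Lp.fourier_toTemperedDistribution_eq (E := ℝ) (F := ℂ) (hg2.toLp g))
    simp only [TemperedDistribution.fourier_apply, Lp.toTemperedDistribution_apply] at this
    rw [← this]
    refine integral_congr_ae ?_
    filter_upwards [hg2.coeFn_toLp] with x hx
    rw [hx, SchwartzMap.fourier_coe]
  have test_fourier : ∫ x, (𝓕 (Φ : ℝ → ℂ)) x • g x = ∫ x, Φ x • 𝓕 g x := by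
    refine (VectorFourier.integral_fourierIntegral_smul_eq_flip (L := innerₗ ℝ)
      Real.continuous_fourierChar (by exact continuous_inner) Φ.integrable hg).trans ?_
    rw [flip_innerₗ]
    rfl
  have smul_eq (f : ℝ → ℂ) (x : ℝ) : φ x • f x = Φ x • f x := by simp [Φ]
  simp_rw [smul_eq]
  rw [← test_fourier, test_h]

theorem memLp_two_fourier {g : ℝ → ℂ} (hg : Integrable g) (hg2 : MemLp g 2) :
    MemLp (𝓕 g) 2 :=
  (memLp_congr_ae (ae_eq_fourier_toLp hg hg2)).mpr (Lp.memLp _)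

/-- Since `x 𝓕 g` is the transform of `g'` up to a constant, `𝓕 g` is the product of the two
square integrable functions `(1 + x²)^{-1/2}` and `(1 + x²)^{1/2} 𝓕 g`. -/
theorem integrable_fourier_of_memLp_two_deriv {g : ℝ → ℂ} (hd : Differentiable ℝ g)
    (hg : Integrable g) (hg2 : MemLp g 2) (hg' : Integrable (deriv g))
    (hg2' : MemLp (deriv g) 2) : Integrable (𝓕 g) := by
  have sq_fourier := (memLp_two_fourier hg hg2).integrable_norm_pow (by norm_num)
  have sq_fourier_deriv := (memLp_two_fourier hg' hg2').integrable_norm_pow (by norm_num)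
  rw [Real.fourier_deriv hg hd hg'] at sq_fourier_deriv
  refine (integrable_inv_one_add_sq.add (sq_fourier.add sq_fourier_deriv)).mono'
    (continuous_fourier hg).aestronglyMeasurable (ae_of_all _ fun x => ?_)
  have norm_sq : ‖(2 * Real.pi * Complex.I * x : ℂ) • 𝓕 g x‖ ^ 2
      = (2 * Real.pi) ^ 2 * (x ^ 2 * ‖𝓕 g x‖ ^ 2) := by
    simp only [norm_smul, norm_mul, Complex.norm_I, Complex.norm_real, Complex.norm_ofNat,
      Real.norm_eq_abs, mul_pow, sq_abs]
    ring
  have two_pi : (1 : ℝ) ≤ (2 * Real.pi) ^ 2 := by nlinarith [Real.pi_gt_three]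
  have amgm (n : ℝ) (hn : 0 ≤ n) : n ≤ (1 + x ^ 2)⁻¹ + (1 + x ^ 2) * n ^ 2 := by
    have : 0 ≤ (1 + x ^ 2)⁻¹ * ((1 + x ^ 2) * n - 1) ^ 2 := by positivity
    have : (1 + x ^ 2)⁻¹ * ((1 + x ^ 2) * n - 1) ^ 2
        = (1 + x ^ 2)⁻¹ + (1 + x ^ 2) * n ^ 2 - 2 * n := by
      field_simp
      ring
    linarith
  have := amgm ‖𝓕 g x‖ (norm_nonneg _)
  have : x ^ 2 * ‖𝓕 g x‖ ^ 2 ≤ (2 * Real.pi) ^ 2 * (x ^ 2 * ‖𝓕 g x‖ ^ 2) :=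
    le_mul_of_one_le_left (by positivity) two_pi
  simp only [Pi.add_apply, norm_sq]
  linarith

end Fourier

/-- The symbols of the operators applied to the densities: differentiable functions of polynomial
growth, together with their derivative, with the Hermitian symmetry which makes the operator
preserve real functions. -/
structure SlowGrowthSymbol (m : ℝ → ℂ) : Prop where
  conj : ∀ ξ, m (-ξ) = starRingEnd ℂ (m ξ)
  differentiable : Differentiable ℝ m
  bound : ∃ (K : ℝ) (n : ℕ), ∀ ξ, ‖m ξ‖ ≤ K * (1 + |ξ|) ^ n ∧ ‖deriv m ξ‖ ≤ K * (1 + |ξ|) ^ n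

namespace SlowGrowthSymbol

theorem const (c : ℝ) : SlowGrowthSymbol (fun _ => (c : ℂ)) where
  conj _ := by simp
  differentiable := by fun_prop
  bound := ⟨|c|, 0, fun ξ => by simp⟩

theorem neg_I_mul : SlowGrowthSymbol (fun ξ => -Complex.I * ξ) where
  conj ξ := by simp
  differentiable := by fun_prop
  bound := by
    refine ⟨1, 1, fun ξ => ⟨by simp, ?_⟩⟩
    have : deriv (fun ξ : ℝ => -Complex.I * (ξ : ℂ)) ξ = -Complex.I := by
      simpa using (Complex.ofRealCLM.hasDerivAt (x := ξ).const_mul (-Complex.I)).deriv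
    rw [this]
    simp

theorem add {m₁ m₂ : ℝ → ℂ} (h₁ : SlowGrowthSymbol m₁) (h₂ : SlowGrowthSymbol m₂) :
    SlowGrowthSymbol (fun ξ => m₁ ξ + m₂ ξ) where
  conj ξ := by simp [h₁.conj, h₂.conj]
  differentiable := h₁.differentiable.add h₂.differentiable
  bound := by
    obtain ⟨K₁, n₁, hb₁⟩ := h₁.bound
    obtain ⟨K₂, n₂, hb₂⟩ := h₂.bound
    have hK₁ : 0 ≤ K₁ := by simpa using (norm_nonneg _).trans (hb₁ 0).1
    have hK₂ : 0 ≤ K₂ := by simpa using (norm_nonneg _).trans (hb₂ 0).1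
    refine ⟨K₁ + K₂, n₁ + n₂, fun ξ => ?_⟩
    have one_le : 1 ≤ 1 + |ξ| := by linarith [abs_nonneg ξ]
    have le₁ : K₁ * (1 + |ξ|) ^ n₁ ≤ K₁ * (1 + |ξ|) ^ (n₁ + n₂) := by gcongr; omega
    have le₂ : K₂ * (1 + |ξ|) ^ n₂ ≤ K₂ * (1 + |ξ|) ^ (n₁ + n₂) := by gcongr; omega
    rw [add_mul, deriv_fun_add (h₁.differentiable ξ) (h₂.differentiable ξ)]
    exact ⟨norm_add_le_of_le ((hb₁ ξ).1.trans le₁) ((hb₂ ξ).1.trans le₂),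
      norm_add_le_of_le ((hb₁ ξ).2.trans le₁) ((hb₂ ξ).2.trans le₂)⟩

theorem mul {m₁ m₂ : ℝ → ℂ} (h₁ : SlowGrowthSymbol m₁) (h₂ : SlowGrowthSymbol m₂) :
    SlowGrowthSymbol (fun ξ => m₁ ξ * m₂ ξ) where
  conj ξ := by simp [h₁.conj, h₂.conj]
  differentiable := h₁.differentiable.mul h₂.differentiable
  bound := by
    obtain ⟨K₁, n₁, hb₁⟩ := h₁.bound
    obtain ⟨K₂, n₂, hb₂⟩ := h₂.bound
    refine ⟨2 * (K₁ * K₂), n₁ + n₂, fun ξ => ?_⟩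
    have le_mul {z w : ℂ} (hz : ‖z‖ ≤ K₁ * (1 + |ξ|) ^ n₁) (hw : ‖w‖ ≤ K₂ * (1 + |ξ|) ^ n₂) :
        ‖z * w‖ ≤ K₁ * K₂ * (1 + |ξ|) ^ (n₁ + n₂) :=
      (norm_mul_le_of_le hz hw).trans_eq (by ring)
    have le := le_mul (hb₁ ξ).1 (hb₂ ξ).1
    rw [mul_assoc, two_mul, deriv_fun_mul (h₁.differentiable ξ) (h₂.differentiable ξ)]
    exact ⟨le.trans (le_add_of_nonneg_left ((norm_nonneg _).trans le)),
      norm_add_le_of_le (le_mul (hb₁ ξ).2 (hb₂ ξ).1) (le_mul (hb₁ ξ).1 (hb₂ ξ).2)⟩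

variable {m : ℝ → ℂ}

theorem const_mul (hm : SlowGrowthSymbol m) (c : ℝ) : SlowGrowthSymbol (fun ξ => (c : ℂ) * m ξ) :=
  (const c).mul hm

theorem neg (hm : SlowGrowthSymbol m) : SlowGrowthSymbol (fun ξ => -m ξ) := by
  simpa using hm.const_mul (-1)

theorem pow (hm : SlowGrowthSymbol m) (n : ℕ) : SlowGrowthSymbol (fun ξ => m ξ ^ n) := by
  induction n with
  | zero => simpa using const 1
  | succ n ih => simpa only [pow_succ] using ih.mul hm

theorem inv (hm : SlowGrowthSymbol m) {κ : ℝ} (hκ : 0 < κ) (hκm : ∀ ξ, κ ≤ ‖m ξ‖) :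
    SlowGrowthSymbol (fun ξ => (m ξ)⁻¹) where
  conj ξ := by simp [hm.conj]
  differentiable ξ := (hm.differentiable ξ).inv (norm_pos_iff.mp (hκ.trans_le (hκm ξ)))
  bound := by
    obtain ⟨K, n, hb⟩ := hm.bound
    have hK : 0 ≤ K := by simpa using (norm_nonneg _).trans (hb 0).1
    refine ⟨κ⁻¹ + K / κ ^ 2, n, fun ξ => ?_⟩
    have one_le : 1 ≤ (1 + |ξ|) ^ n := one_le_pow₀ (by linarith [abs_nonneg ξ])
    have ne_zero : m ξ ≠ 0 := norm_pos_iff.mp (hκ.trans_le (hκm ξ))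
    rw [((hm.differentiable ξ).hasDerivAt.fun_inv ne_zero).deriv, norm_inv, norm_div, norm_neg,
      norm_pow, add_mul]
    constructor
    · calc ‖m ξ‖⁻¹ ≤ κ⁻¹ := inv_anti₀ hκ (hκm ξ)
        _ ≤ κ⁻¹ * (1 + |ξ|) ^ n := le_mul_of_one_le_right (by positivity) one_le
        _ ≤ κ⁻¹ * (1 + |ξ|) ^ n + K / κ ^ 2 * (1 + |ξ|) ^ n :=
          le_add_of_nonneg_right (by positivity)
    · calc ‖deriv m ξ‖ / ‖m ξ‖ ^ 2 ≤ K * (1 + |ξ|) ^ n / κ ^ 2 := by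
            gcongr
            · exact (hb ξ).2
            · exact hκm ξ
        _ = K / κ ^ 2 * (1 + |ξ|) ^ n := by ring
        _ ≤ κ⁻¹ * (1 + |ξ|) ^ n + K / κ ^ 2 * (1 + |ξ|) ^ n :=
          le_add_of_nonneg_left (by positivity)

theorem cexp_neg (hm : SlowGrowthSymbol m) (hre : ∀ ξ, 0 ≤ (m ξ).re) :
    SlowGrowthSymbol (fun ξ => Complex.exp (-m ξ)) where
  conj ξ := by simp [hm.conj, ← Complex.exp_conj]
  differentiable := hm.differentiable.neg.cexp
  bound := by
    obtain ⟨K, n, hb⟩ := hm.bound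
    refine ⟨1 + K, n, fun ξ => ?_⟩
    have one_le : 1 ≤ (1 + |ξ|) ^ n := one_le_pow₀ (by linarith [abs_nonneg ξ])
    have exp_le : ‖Complex.exp (-m ξ)‖ ≤ 1 := by simpa [Complex.norm_exp] using hre ξ
    rw [(hm.differentiable ξ).hasDerivAt.fun_neg.cexp.deriv, norm_mul, norm_neg, one_add_mul]
    exact ⟨exp_le.trans (one_le.trans (le_add_of_nonneg_right ((norm_nonneg _).trans (hb ξ).1))),
      (mul_le_of_le_one_left (norm_nonneg _) exp_le).trans
        ((hb ξ).2.trans (le_add_of_nonneg_left (by positivity)))⟩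

end SlowGrowthSymbol

/-- The Fourier transforms of the densities: Hermitian differentiable functions which decay faster
than every power of the frequency, together with their derivative. Unlike Schwartz functions they
need not be twice differentiable, since neither are the symbols `ψ_{α,θ}`. -/
structure RapidDecaySymbol (g : ℝ → ℂ) : Prop where
  conj : ∀ ξ, g (-ξ) = starRingEnd ℂ (g ξ)
  differentiable : Differentiable ℝ g
  bound : ∀ n : ℕ, ∃ C : ℝ, ∀ ξ,
    (1 + |ξ|) ^ n * ‖g ξ‖ ≤ C ∧ (1 + |ξ|) ^ n * ‖deriv g ξ‖ ≤ C

theorem integrable_of_one_add_abs_sq_mul_norm_le {f : ℝ → ℂ} (hf : AEStronglyMeasurable f)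
    {C : ℝ} (hC : ∀ ξ, (1 + |ξ|) ^ 2 * ‖f ξ‖ ≤ C) : Integrable f := by
  refine (integrable_inv_one_add_sq.const_mul C).mono' hf (ae_of_all _ fun ξ => ?_)
  rw [← div_eq_mul_inv, le_div_iff₀' (by positivity)]
  refine le_trans ?_ (hC ξ)
  gcongr
  nlinarith [abs_nonneg ξ, sq_abs ξ]

theorem memLp_two_of_one_add_abs_sq_mul_norm_le {f : ℝ → ℂ} (hf : AEStronglyMeasurable f)
    {C : ℝ} (hC : ∀ ξ, (1 + |ξ|) ^ 2 * ‖f ξ‖ ≤ C) : MemLp f 2 := by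
  have norm_le (ξ : ℝ) : ‖f ξ‖ ≤ C :=
    (le_mul_of_one_le_left (norm_nonneg _)
      (one_le_pow₀ (by linarith [abs_nonneg ξ]))).trans (hC ξ)
  rw [memLp_two_iff_integrable_sq_norm hf]
  simp_rw [sq]
  exact (integrable_of_one_add_abs_sq_mul_norm_le hf hC).norm.bdd_mul hf.norm
    (ae_of_all _ fun ξ => by simpa using norm_le ξ)

namespace RapidDecaySymbol

open FourierTransform

variable {g m : ℝ → ℂ}

theorem mul (hg : RapidDecaySymbol g) (hm : SlowGrowthSymbol m) :
    RapidDecaySymbol (fun ξ => m ξ * g ξ) where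
  conj ξ := by simp [hm.conj, hg.conj]
  differentiable := hm.differentiable.mul hg.differentiable
  bound n := by
    obtain ⟨K, k, hb⟩ := hm.bound
    obtain ⟨C, hC⟩ := hg.bound (n + k)
    have hK : 0 ≤ K := by simpa using (norm_nonneg _).trans (hb 0).1
    refine ⟨2 * (K * C), fun ξ => ?_⟩
    have le_mul {z w : ℂ} (hz : ‖z‖ ≤ K * (1 + |ξ|) ^ k) (hw : (1 + |ξ|) ^ (n + k) * ‖w‖ ≤ C) :
        (1 + |ξ|) ^ n * ‖z * w‖ ≤ K * C := by
      calc (1 + |ξ|) ^ n * ‖z * w‖ ≤ (1 + |ξ|) ^ n * (K * (1 + |ξ|) ^ k * ‖w‖) := by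
            rw [norm_mul]
            gcongr
        _ = K * ((1 + |ξ|) ^ (n + k) * ‖w‖) := by ring
        _ ≤ K * C := by gcongr
    have le := le_mul (hb ξ).1 (hC ξ).1
    rw [two_mul, deriv_fun_mul (hm.differentiable ξ) (hg.differentiable ξ)]
    refine ⟨le.trans (le_add_of_nonneg_left (le.trans' (by positivity))), ?_⟩
    calc (1 + |ξ|) ^ n * ‖deriv m ξ * g ξ + m ξ * deriv g ξ‖
        ≤ (1 + |ξ|) ^ n * (‖deriv m ξ * g ξ‖ + ‖m ξ * deriv g ξ‖) := by
          gcongr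
          exact norm_add_le _ _
      _ = (1 + |ξ|) ^ n * ‖deriv m ξ * g ξ‖ + (1 + |ξ|) ^ n * ‖m ξ * deriv g ξ‖ := mul_add ..
      _ ≤ K * C + K * C := add_le_add (le_mul (hb ξ).2 (hC ξ).1) (le_mul (hb ξ).1 (hC ξ).2)

variable (hg : RapidDecaySymbol g)
include hg

theorem integrable : Integrable g := by
  obtain ⟨C, hC⟩ := hg.bound 2
  exact integrable_of_one_add_abs_sq_mul_norm_le hg.differentiable.continuous.aestronglyMeasurable
    fun ξ => (hC ξ).1

theorem integrable_deriv : Integrable (deriv g) := by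
  obtain ⟨C, hC⟩ := hg.bound 2
  exact integrable_of_one_add_abs_sq_mul_norm_le (measurable_deriv g).aestronglyMeasurable
    fun ξ => (hC ξ).2

theorem integrable_fourier : Integrable (𝓕 g) := by
  obtain ⟨C, hC⟩ := hg.bound 2
  exact integrable_fourier_of_memLp_two_deriv hg.differentiable hg.integrable
    (memLp_two_of_one_add_abs_sq_mul_norm_le hg.differentiable.continuous.aestronglyMeasurable
      fun ξ => (hC ξ).1) hg.integrable_deriv
    (memLp_two_of_one_add_abs_sq_mul_norm_le (measurable_deriv g).aestronglyMeasurable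
      fun ξ => (hC ξ).2)

end RapidDecaySymbol

/-- The inverse of the Fourier transform `fourierPos`. The real part loses nothing: the functions
`g` of interest are Hermitian, so that the integral is real. -/
noncomputable def invFourierPos (g : ℝ → ℂ) (x : ℝ) : ℝ :=
  ((2 * Real.pi : ℂ)⁻¹ * ∫ ξ : ℝ, Complex.exp (-(Complex.I * ξ * x)) * g ξ).re

section InvFourierPos

open FourierTransform

theorem integrable_exp_mul {g : ℝ → ℂ} (hg : Integrable g) (x : ℝ) :
    Integrable (fun ξ : ℝ => Complex.exp (-(Complex.I * ξ * x)) * g ξ) :=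
  hg.bdd_mul (c := 1) (by fun_prop) (ae_of_all _ fun ξ => by simp [Complex.norm_exp])

theorem invFourierPos_add {g h : ℝ → ℂ} (hg : Integrable g) (hh : Integrable h) (x : ℝ) :
    invFourierPos (fun ξ => g ξ + h ξ) x = invFourierPos g x + invFourierPos h x := by
  simp only [invFourierPos, mul_add]
  rw [integral_add (integrable_exp_mul hg x) (integrable_exp_mul hh x), mul_add, Complex.add_re]

theorem invFourierPos_const_mul (c : ℝ) (g : ℝ → ℂ) (x : ℝ) :
    invFourierPos (fun ξ => c * g ξ) x = c * invFourierPos g x := by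
  simp only [invFourierPos, mul_left_comm _ (c : ℂ)]
  rw [integral_const_mul, mul_left_comm, Complex.re_ofReal_mul]

theorem invFourierPos_sub {g h : ℝ → ℂ} (hg : Integrable g) (hh : Integrable h) (x : ℝ) :
    invFourierPos (fun ξ => g ξ - h ξ) x = invFourierPos g x - invFourierPos h x := by
  simp only [invFourierPos, mul_sub]
  rw [integral_sub (integrable_exp_mul hg x) (integrable_exp_mul hh x), mul_sub, Complex.sub_re]

theorem invFourierPos_sum {ι : Type*} (s : Finset ι) (c : ι → ℝ) (g : ι → ℝ → ℂ)
    (hg : ∀ i, Integrable (g i)) (x : ℝ) :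
    invFourierPos (fun ξ => ∑ i ∈ s, c i * g i ξ) x = ∑ i ∈ s, c i * invFourierPos (g i) x := by
  classical
  induction s using Finset.induction_on with
  | empty => simp [invFourierPos]
  | insert i s hi ih =>
    simp only [Finset.sum_insert hi]
    rw [invFourierPos_add ((hg i).const_mul _)
      (integrable_finsetSum _ fun j _ => (hg j).const_mul _), ih, invFourierPos_const_mul]

theorem abs_invFourierPos_le (g : ℝ → ℂ) (x : ℝ) : |invFourierPos g x| ≤ ∫ ξ, ‖g ξ‖ := by
  have inv_two_pi_le : ‖(2 * Real.pi : ℂ)⁻¹‖ ≤ 1 := by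
    simp only [norm_inv, norm_mul, Complex.norm_ofNat, Complex.norm_real,
      Real.norm_of_nonneg Real.pi_pos.le]
    exact inv_le_one_of_one_le₀ (by linarith [Real.pi_gt_three])
  calc |invFourierPos g x|
      ≤ ‖(2 * Real.pi : ℂ)⁻¹‖ * ‖∫ ξ : ℝ, Complex.exp (-(Complex.I * ξ * x)) * g ξ‖ := by
        rw [← norm_mul]
        exact Complex.abs_re_le_norm _
    _ ≤ ‖∫ ξ : ℝ, Complex.exp (-(Complex.I * ξ * x)) * g ξ‖ :=
        mul_le_of_le_one_left (norm_nonneg _) inv_two_pi_le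
    _ ≤ ∫ ξ : ℝ, ‖Complex.exp (-(Complex.I * ξ * x)) * g ξ‖ := norm_integral_le_integral_norm _
    _ = ∫ ξ, ‖g ξ‖ := by simp [Complex.norm_exp]

theorem invFourierPos_eq_re_fourier (g : ℝ → ℂ) (x : ℝ) :
    invFourierPos g x = ((2 * Real.pi : ℂ)⁻¹ * 𝓕 g (x / (2 * Real.pi))).re := by
  have : (Real.pi : ℂ) ≠ 0 := by exact_mod_cast Real.pi_ne_zero
  rw [invFourierPos, Real.fourier_eq']
  congr 3 with ξ
  rw [smul_eq_mul]
  congr 2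
  simp
  field_simp

theorem ofReal_invFourierPos {g : ℝ → ℂ} (hg : ∀ ξ, g (-ξ) = starRingEnd ℂ (g ξ)) (x : ℝ) :
    (invFourierPos g x : ℂ) = (2 * Real.pi : ℂ)⁻¹ * 𝓕 g (x / (2 * Real.pi)) := by
  rw [invFourierPos_eq_re_fourier]
  refine Complex.conj_eq_iff_re.mp ?_
  rw [map_mul, Real.fourier_eq', ← integral_conj, ← integral_neg_eq_self]
  simp [Complex.conj_ofNat, hg, ← Complex.exp_conj]

theorem fourierPos_eq_fourier (f : ℝ → ℝ) (ξ : ℝ) :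
    fourierPos f ξ = 𝓕 (fun x => (f x : ℂ)) (-ξ / (2 * Real.pi)) := by
  have : (Real.pi : ℂ) ≠ 0 := by exact_mod_cast Real.pi_ne_zero
  rw [fourierPos, Real.fourier_eq']
  congr 1 with x
  rw [smul_eq_mul]
  congr 2
  simp
  field_simp

theorem hasDerivAt_fourierPos {f : ℝ → ℝ} (hf : Integrable f)
    (hf' : Integrable (fun x => x * f x)) (ξ : ℝ) :
    HasDerivAt (fourierPos f) (Complex.I * fourierPos (fun x => x * f x) ξ) ξ := by
  have : (Real.pi : ℂ) ≠ 0 := by exact_mod_cast Real.pi_ne_zero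
  have deriv_fourier := Real.hasDerivAt_fourier (hf.ofReal (𝕜 := ℂ))
    (by simpa using hf'.ofReal (𝕜 := ℂ)) (-ξ / (2 * Real.pi))
  have := deriv_fourier.scomp ξ ((hasDerivAt_id ξ).neg.div_const (2 * Real.pi))
  rw [funext (fourierPos_eq_fourier f), fourierPos_eq_fourier]
  refine this.congr_deriv ?_
  rw [Real.fourier_eq', Real.fourier_eq', ← integral_const_mul, ← integral_smul]
  congr 1 with x
  simp
  field_simp

theorem hasDerivAt_invFourierPos_of_dominated {F F' : ℝ → ℝ → ℂ} {t : ℝ} {s : Set ℝ}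
    (hs : s ∈ 𝓝 t) {bound : ℝ → ℝ} (hbound : Integrable bound)
    (hF : ∀ r ∈ s, Integrable (F r)) (hF' : Continuous (F' t))
    (hdom : ∀ ξ, ∀ r ∈ s, ‖F' r ξ‖ ≤ bound ξ)
    (hderiv : ∀ ξ, ∀ r ∈ s, HasDerivAt (fun r => F r ξ) (F' r ξ) r) (x : ℝ) :
    HasDerivAt (fun r => invFourierPos (F r) x) (invFourierPos (F' t) x) t := by
  have deriv_integral := (hasDerivAt_integral_of_dominated_loc_of_deriv_le (μ := volume) (𝕜 := ℝ)
    (F := fun r (ξ : ℝ) => Complex.exp (-(Complex.I * ξ * x)) * F r ξ)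
    (F' := fun r (ξ : ℝ) => Complex.exp (-(Complex.I * ξ * x)) * F' r ξ) hs
    (by filter_upwards [hs] with r hr using (integrable_exp_mul (hF r hr) x).1)
    (integrable_exp_mul (hF t (mem_of_mem_nhds hs)) x) (by fun_prop)
    (ae_of_all _ fun ξ r hr => by simpa [Complex.norm_exp] using hdom ξ r hr) hbound
    (ae_of_all _ fun ξ r hr => (hderiv ξ r hr).const_mul _)).2
  exact Complex.reCLM.hasFDerivAt.comp_hasDerivAt t (deriv_integral.const_mul _)

end InvFourierPos

namespace RapidDecaySymbol

open FourierTransform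

variable {g m : ℝ → ℂ} (hg : RapidDecaySymbol g)
include hg

theorem continuous_invFourierPos : Continuous (invFourierPos g) := by
  have := continuous_fourier hg.integrable
  simp_rw [funext (invFourierPos_eq_re_fourier g)]
  fun_prop

theorem integrable_invFourierPos : Integrable (invFourierPos g) := by
  simp_rw [funext (invFourierPos_eq_re_fourier g)]
  exact ((hg.integrable_fourier.comp_div (by positivity)).const_mul _).re

theorem fourierPos_invFourierPos (ξ : ℝ) : fourierPos (invFourierPos g) ξ = g ξ := by
  have : (Real.pi : ℂ) ≠ 0 := by exact_mod_cast Real.pi_ne_zero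
  have inversion := congrFun (hg.differentiable.continuous.fourierInv_fourier_eq hg.integrable
    hg.integrable_fourier) ξ
  rw [Real.fourierInv_eq'] at inversion
  set wave : ℝ → ℂ := fun y =>
    Complex.exp (↑(2 * Real.pi * inner ℝ y ξ) * Complex.I) • 𝓕 g y with wave_def
  have rescale (x : ℝ) : Complex.exp (Complex.I * ξ * x) * (invFourierPos g x : ℂ)
      = (2 * Real.pi : ℂ)⁻¹ * wave (x / (2 * Real.pi)) := by
    rw [ofReal_invFourierPos hg.conj, mul_left_comm, wave_def]
    simp only [smul_eq_mul]
    congr 3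
    simp
    field_simp
  rw [fourierPos, ← inversion, funext rescale, integral_const_mul,
    Measure.integral_comp_div wave, abs_of_pos (by positivity), Complex.real_smul]
  push_cast
  field_simp

theorem isFourierMultiplier (hm : SlowGrowthSymbol m) :
    IsFourierMultiplier m (invFourierPos g) (invFourierPos fun ξ => m ξ * g ξ) where
  integrable_left := hg.integrable_invFourierPos
  integrable_right := (hg.mul hm).integrable_invFourierPos
  continuous_right := (hg.mul hm).continuous_invFourierPos
  fourier_eq ξ _ := by rw [hg.fourierPos_invFourierPos, (hg.mul hm).fourierPos_invFourierPos]

theorem hasDerivAt_invFourierPos (x : ℝ) :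
    HasDerivAt (invFourierPos g) (invFourierPos (fun ξ => -Complex.I * ξ * g ξ) x) x := by
  have : (Real.pi : ℂ) ≠ 0 := by exact_mod_cast Real.pi_ne_zero
  have integrable_mul : Integrable (fun ξ : ℝ => ξ • g ξ) := by
    refine ((hg.mul .neg_I_mul).integrable.const_mul Complex.I).congr (ae_of_all _ fun ξ => ?_)
    simp [← mul_assoc]
  have deriv_fourier := (Real.hasDerivAt_fourier hg.integrable integrable_mul
    (x / (2 * Real.pi))).scomp x ((hasDerivAt_id x).div_const (2 * Real.pi))
  simp_rw [funext (invFourierPos_eq_re_fourier g), invFourierPos_eq_re_fourier]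
  refine (Complex.reCLM.hasFDerivAt.comp_hasDerivAt x
    (deriv_fourier.const_mul (2 * Real.pi : ℂ)⁻¹)).congr_deriv ?_
  rw [Complex.reCLM_apply, Real.fourier_eq', Real.fourier_eq', ← integral_smul]
  congr 3 with ξ
  simp
  field_simp

theorem mul_invFourierPos (x : ℝ) :
    x * invFourierPos g x = invFourierPos (fun ξ => -Complex.I * deriv g ξ) x := by
  have : (Real.pi : ℂ) ≠ 0 := by exact_mod_cast Real.pi_ne_zero
  have fourier_deriv := congrFun (Real.fourier_deriv hg.integrable hg.differentiable
    hg.integrable_deriv) (x / (2 * Real.pi))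
  have : 𝓕 (fun ξ => -Complex.I * deriv g ξ) (x / (2 * Real.pi))
      = x * 𝓕 g (x / (2 * Real.pi)) := by
    calc 𝓕 (fun ξ => -Complex.I * deriv g ξ) (x / (2 * Real.pi))
        = -Complex.I * 𝓕 (deriv g) (x / (2 * Real.pi)) := by
          simp only [Real.fourier_eq', smul_eq_mul, ← integral_const_mul]
          congr 1 with ξ
          ring
      _ = x * 𝓕 g (x / (2 * Real.pi)) := by
          rw [fourier_deriv, smul_eq_mul, ← mul_assoc]
          congr 1
          push_cast
          field_simp
          simp
  rw [invFourierPos_eq_re_fourier, invFourierPos_eq_re_fourier, this, mul_left_comm,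
    Complex.re_ofReal_mul]

theorem iteratedDeriv_invFourierPos (n : ℕ) :
    iteratedDeriv n (invFourierPos g) = invFourierPos fun ξ => (-Complex.I * ξ) ^ n * g ξ := by
  induction n with
  | zero => simp
  | succ n ih =>
    ext x
    rw [iteratedDeriv_succ, ih,
      ((hg.mul (SlowGrowthSymbol.neg_I_mul.pow n)).hasDerivAt_invFourierPos x).deriv]
    simp_rw [pow_succ', mul_assoc]

theorem contDiff_invFourierPos : ContDiff ℝ (⊤ : ℕ∞) (invFourierPos g) :=
  contDiff_of_differentiable_iteratedDeriv fun n _ x => by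
    rw [hg.iteratedDeriv_invFourierPos]
    exact ((hg.mul (SlowGrowthSymbol.neg_I_mul.pow n)).hasDerivAt_invFourierPos
      x).differentiableAt

end RapidDecaySymbol

theorem one_add_pow_mul_exp_neg_mul_le {κ : ℝ} (hκ : 0 < κ) (n : ℕ) {r : ℝ} (hr : 0 ≤ r) :
    (1 + r) ^ n * Real.exp (-(κ * (r - 1))) ≤ n.factorial * κ⁻¹ ^ n * Real.exp (2 * κ) := by
  have pow_le := Real.pow_div_factorial_le_exp (x := κ * (1 + r)) (by positivity) n
  rw [div_le_iff₀ (by positivity)] at pow_le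
  calc (1 + r) ^ n * Real.exp (-(κ * (r - 1)))
      = κ⁻¹ ^ n * (κ * (1 + r)) ^ n * Real.exp (-(κ * (r - 1))) := by
        rw [← mul_pow, inv_mul_cancel_left₀ hκ.ne']
    _ ≤ κ⁻¹ ^ n * (Real.exp (κ * (1 + r)) * n.factorial) * Real.exp (-(κ * (r - 1))) := by gcongr
    _ = n.factorial * κ⁻¹ ^ n * (Real.exp (κ * (1 + r)) * Real.exp (-(κ * (r - 1)))) := by ring
    _ = n.factorial * κ⁻¹ ^ n * Real.exp (2 * κ) := by rw [← Real.exp_add]; ring_nf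

theorem SlowGrowthSymbol.rapidDecay_cexp_neg {m : ℝ → ℂ} (hm : SlowGrowthSymbol m) {κ : ℝ}
    (hκ : 0 < κ) (hre : ∀ ξ, κ * (|ξ| - 1) ≤ (m ξ).re) :
    RapidDecaySymbol (fun ξ => Complex.exp (-m ξ)) where
  conj ξ := by simp [hm.conj, ← Complex.exp_conj]
  differentiable := hm.differentiable.neg.cexp
  bound n := by
    obtain ⟨K, k, hb⟩ := hm.bound
    have hK : 0 ≤ K := by simpa using (norm_nonneg _).trans (hb 0).1
    have pow_mul_le (l : ℕ) (ξ : ℝ) : (1 + |ξ|) ^ l * ‖Complex.exp (-m ξ)‖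
        ≤ l.factorial * κ⁻¹ ^ l * Real.exp (2 * κ) := by
      refine le_trans ?_ (one_add_pow_mul_exp_neg_mul_le hκ l (abs_nonneg ξ))
      rw [Complex.norm_exp, Complex.neg_re]
      gcongr
      exact hre ξ
    set C : ℕ → ℝ := fun l => l.factorial * κ⁻¹ ^ l * Real.exp (2 * κ)
    have hC (l : ℕ) : 0 ≤ C l := by positivity
    refine ⟨C n + K * C (n + k), fun ξ => ⟨?_, ?_⟩⟩
    · exact (pow_mul_le n ξ).trans (le_add_of_nonneg_right (mul_nonneg hK (hC _)))
    · rw [(hm.differentiable ξ).hasDerivAt.fun_neg.cexp.deriv, norm_mul, norm_neg]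
      calc (1 + |ξ|) ^ n * (‖Complex.exp (-m ξ)‖ * ‖deriv m ξ‖)
          ≤ (1 + |ξ|) ^ n * (‖Complex.exp (-m ξ)‖ * (K * (1 + |ξ|) ^ k)) := by
            gcongr
            exact (hb ξ).2
        _ = K * ((1 + |ξ|) ^ (n + k) * ‖Complex.exp (-m ξ)‖) := by ring
        _ ≤ K * C (n + k) := by
            gcongr
            exact pow_mul_le _ _
        _ ≤ C n + K * C (n + k) := le_add_of_nonneg_left (hC _)

/-- The characteristic exponents for which the densities are studied: symbols with nonnegative real
part of at least linear growth. -/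
structure CoerciveSymbol (ψ : ℝ → ℂ) : Prop extends SlowGrowthSymbol ψ where
  re_nonneg : ∀ ξ, 0 ≤ (ψ ξ).re
  coercive : ∃ κ : ℝ, 0 < κ ∧ ∀ ξ, κ * (|ξ| - 1) ≤ (ψ ξ).re

namespace CoerciveSymbol

variable {ψ : ℝ → ℂ} (hψ : CoerciveSymbol ψ)
include hψ

theorem slowGrowth_cexp_neg : SlowGrowthSymbol (fun ξ => Complex.exp (-ψ ξ)) :=
  hψ.toSlowGrowthSymbol.cexp_neg hψ.re_nonneg

theorem rapidDecay_cexp_neg_mul {b : ℝ} (hb : 0 < b) :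
    RapidDecaySymbol (fun ξ => Complex.exp (-(b * ψ ξ))) := by
  obtain ⟨κ, hκ, hre⟩ := hψ.coercive
  refine (hψ.toSlowGrowthSymbol.const_mul b).rapidDecay_cexp_neg (mul_pos hb hκ) fun ξ => ?_
  rw [Complex.re_ofReal_mul, mul_assoc]
  exact mul_le_mul_of_nonneg_left (hre ξ) hb.le

end CoerciveSymbol

/-- The mixture `∑ n, q (1 - q) ^ n e^{-(b + n) w}` of exponentials, with geometric weights. For
`w = ψ(ξ)` it is the characteristic function of the process with exponent `ψ` at the random time
`b + N`, where `N` is geometric with parameter `q`. -/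
noncomputable def geometricMixture (q b : ℝ) (w : ℂ) : ℂ :=
  q * Complex.exp (-(b * w)) * (1 - (1 - q) * Complex.exp (-w))⁻¹

/-- The derivative of `geometricMixture q b`. -/
noncomputable def geometricMixtureDeriv (q b : ℝ) (w : ℂ) : ℂ :=
  -(b + (1 - q) * Complex.exp (-w) * (1 - (1 - q) * Complex.exp (-w))⁻¹) * geometricMixture q b w

section GeometricMixture

variable {q b : ℝ} {w : ℂ}

theorem norm_one_sub_mul_cexp_neg_le (hw : 0 ≤ w.re) :
    ‖((1 - q : ℝ) : ℂ) * Complex.exp (-w)‖ ≤ |1 - q| := by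
  rw [norm_mul, Complex.norm_real, Real.norm_eq_abs]
  exact mul_le_of_le_one_right (abs_nonneg _) (by simpa [Complex.norm_exp] using hw)

theorem one_sub_abs_le_norm_one_sub_mul_cexp_neg (q : ℝ) (hw : 0 ≤ w.re) :
    1 - |1 - q| ≤ ‖1 - (1 - q) * Complex.exp (-w)‖ := by
  have := norm_sub_norm_le (1 : ℂ) (((1 - q : ℝ) : ℂ) * Complex.exp (-w))
  have := norm_one_sub_mul_cexp_neg_le (q := q) hw
  simp only [norm_one, Complex.ofReal_sub, Complex.ofReal_one] at *
  linarith

theorem one_sub_mul_cexp_neg_ne_zero (hq : |1 - q| < 1) (hw : 0 ≤ w.re) :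
    1 - (1 - q) * Complex.exp (-w) ≠ 0 :=
  norm_pos_iff.mp ((sub_pos.mpr hq).trans_le (one_sub_abs_le_norm_one_sub_mul_cexp_neg q hw))

theorem geometricMixture_zero (hq : |1 - q| < 1) : geometricMixture q b 0 = 1 := by
  have : (q : ℂ) ≠ 0 := by
    rintro h
    simp [Complex.ofReal_eq_zero.mp h] at hq
  simp [geometricMixture, this]

theorem hasSum_geometricMixture (b : ℝ) (hq : |1 - q| < 1) (hw : 0 ≤ w.re) :
    HasSum (fun n : ℕ => ((q * (1 - q) ^ n : ℝ) : ℂ) * Complex.exp (-((b + n : ℝ) * w)))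
      (geometricMixture q b w) := by
  have := (hasSum_geometric_of_norm_lt_one
    ((norm_one_sub_mul_cexp_neg_le (q := q) hw).trans_lt hq)).mul_left
    (q * Complex.exp (-(b * w)))
  push_cast at this
  refine this.congr_fun fun n => ?_
  push_cast
  rw [show -((b + n) * w) = -(b * w) + n * -w by ring, Complex.exp_add, Complex.exp_nat_mul,
    mul_pow]
  ring

theorem hasDerivAt_geometricMixture (hq : |1 - q| < 1) (hw : 0 ≤ w.re) :
    HasDerivAt (geometricMixture q b) (geometricMixtureDeriv q b w) w := by
  have denom_ne := one_sub_mul_cexp_neg_ne_zero hq hw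
  have deriv_exp := ((hasDerivAt_id w).const_mul (b : ℂ)).fun_neg.cexp.const_mul (q : ℂ)
  have deriv_denom := ((hasDerivAt_id w).fun_neg.cexp.const_mul (1 - q : ℂ)).const_sub 1
  refine (deriv_exp.mul (deriv_denom.fun_inv denom_ne)).congr_deriv ?_
  simp only [geometricMixtureDeriv, geometricMixture, id]
  field_simp
  ring

theorem norm_geometricMixture_le (hq : |1 - q| < 1) (hw : 0 ≤ w.re) :
    ‖geometricMixture q b w‖ ≤ 2 / (1 - |1 - q|) * Real.exp (-(b * w.re)) := by
  have : 0 < 1 - |1 - q| := sub_pos.mpr hq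
  have abs_le : |q| ≤ 2 := abs_le.mpr (by constructor <;> linarith [abs_lt.mp hq])
  rw [geometricMixture, norm_mul, norm_mul, Complex.norm_real, Real.norm_eq_abs, norm_inv,
    Complex.norm_exp, Complex.neg_re, Complex.re_ofReal_mul, div_eq_mul_inv, mul_right_comm]
  gcongr
  exact one_sub_abs_le_norm_one_sub_mul_cexp_neg q hw

theorem norm_geometricMixtureDeriv_le (hb : 0 ≤ b) (hq : |1 - q| < 1) (hw : 0 ≤ w.re) :
    ‖geometricMixtureDeriv q b w‖
      ≤ (b + (1 - |1 - q|)⁻¹) * (2 / (1 - |1 - q|)) * Real.exp (-(b * w.re)) := by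
  have : 0 < 1 - |1 - q| := sub_pos.mpr hq
  rw [geometricMixtureDeriv, norm_mul, norm_neg, mul_assoc (b + _)]
  gcongr
  · refine norm_add_le_of_le (by rw [Complex.norm_real, Real.norm_of_nonneg hb]) ?_
    rw [norm_mul, norm_inv]
    have := (norm_one_sub_mul_cexp_neg_le (q := q) hw).trans hq.le
    push_cast at this
    refine (mul_le_of_le_one_left (by positivity) this).trans ?_
    gcongr
    exact one_sub_abs_le_norm_one_sub_mul_cexp_neg q hw
  · exact norm_geometricMixture_le hq hw

theorem norm_one_sub_geometricMixture_le (hb : 0 ≤ b) (hq : |1 - q| < 1) (hw : 0 ≤ w.re) :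
    ‖1 - geometricMixture q b w‖ ≤ (b + (1 - |1 - q|)⁻¹) * (2 / (1 - |1 - q|)) * ‖w‖ := by
  have : 0 < 1 - |1 - q| := sub_pos.mpr hq
  have deriv_le (z : ℂ) (hz : 0 ≤ z.re) :
      ‖geometricMixtureDeriv q b z‖ ≤ (b + (1 - |1 - q|)⁻¹) * (2 / (1 - |1 - q|)) :=
    (norm_geometricMixtureDeriv_le hb hq hz).trans <| mul_le_of_le_one_right (by positivity)
      (Real.exp_le_one_iff.mpr (neg_nonpos.mpr (mul_nonneg hb hz)))
  have := (convex_halfSpace_re_ge 0).norm_image_sub_le_of_norm_hasDerivWithin_le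
    (fun z hz => (hasDerivAt_geometricMixture (b := b) hq hz).hasDerivWithinAt) deriv_le
    (x := w) (y := 0) hw (show 0 ≤ (0 : ℂ).re from le_rfl)
  simpa [geometricMixture_zero hq] using this

end GeometricMixture

namespace CoerciveSymbol

variable {ψ : ℝ → ℂ} (hψ : CoerciveSymbol ψ) {q b : ℝ} (hq : |1 - q| < 1)
include hψ hq

theorem slowGrowth_inv_one_sub_mul_cexp_neg :
    SlowGrowthSymbol (fun ξ => (1 - (1 - q) * Complex.exp (-ψ ξ))⁻¹) := by
  refine SlowGrowthSymbol.inv ?_ (sub_pos.mpr hq) fun ξ =>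
    one_sub_abs_le_norm_one_sub_mul_cexp_neg q (hψ.re_nonneg ξ)
  simpa [sub_eq_add_neg] using
    (SlowGrowthSymbol.const 1).add (hψ.slowGrowth_cexp_neg.const_mul (1 - q)).neg

theorem rapidDecay_geometricMixture (hb : 0 < b) :
    RapidDecaySymbol (fun ξ => geometricMixture q b (ψ ξ)) := by
  convert (hψ.rapidDecay_cexp_neg_mul hb).mul
    ((hψ.slowGrowth_inv_one_sub_mul_cexp_neg hq).const_mul q) using 2 with ξ
  rw [geometricMixture, mul_right_comm]

theorem rapidDecay_geometricMixtureDeriv (hb : 0 < b) :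
    RapidDecaySymbol (fun ξ => geometricMixtureDeriv q b (ψ ξ)) := by
  convert (hψ.rapidDecay_geometricMixture hq hb).mul
    (((SlowGrowthSymbol.const b).add ((hψ.slowGrowth_cexp_neg.const_mul (1 - q)).mul
      (hψ.slowGrowth_inv_one_sub_mul_cexp_neg hq))).neg) using 2 with ξ
  rw [geometricMixtureDeriv]
  push_cast
  rfl

end CoerciveSymbol

/-- The characteristic function of `𝒮(a t + B(t))`, as a function of the characteristic exponent
`w = ψ(ξ)` of `𝒮`: the Yule process `B(t)` is geometric with parameter `e^{-λ t}`. -/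
noncomputable def yuleMixture (a rate t : ℝ) (w : ℂ) : ℂ :=
  geometricMixture (Real.exp (-(rate * t))) (1 + a * t) w

/-- The derivative of `yuleMixture a rate t w` with respect to `w`. -/
noncomputable def yuleMixtureDeriv (a rate t : ℝ) (w : ℂ) : ℂ :=
  geometricMixtureDeriv (Real.exp (-(rate * t))) (1 + a * t) w

/-- The derivative of `yuleMixture a rate t w` with respect to `t`. -/
noncomputable def yuleMixtureTimeDeriv (a rate t : ℝ) (w : ℂ) : ℂ :=
  -(a * w + rate * ((1 - Complex.exp (-w)) *
    (1 - (1 - Real.exp (-(rate * t))) * Complex.exp (-w))⁻¹)) * yuleMixture a rate t w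

theorem abs_one_sub_exp_neg_lt_one {r : ℝ} (hr : 0 ≤ r) : |1 - Real.exp (-r)| < 1 := by
  have := Real.exp_pos (-r)
  have : Real.exp (-r) ≤ 1 := Real.exp_le_one_iff.mpr (neg_nonpos.mpr hr)
  rw [abs_of_nonneg (by linarith)]
  linarith

section YuleMixture

variable {a rate t : ℝ} {w : ℂ}

theorem hasDerivAt_yuleMixture (hq : |1 - Real.exp (-(rate * t))| < 1) (hw : 0 ≤ w.re) :
    HasDerivAt (fun s => yuleMixture a rate s w) (yuleMixtureTimeDeriv a rate t w) t := by
  have denom_ne := one_sub_mul_cexp_neg_ne_zero hq hw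
  have deriv_q : HasDerivAt (fun s : ℝ => ((Real.exp (-(rate * s)) : ℝ) : ℂ))
      (-(rate * Real.exp (-(rate * t)) : ℝ)) t := by
    refine (((hasDerivAt_id t).const_mul rate).fun_neg.exp.ofReal_comp).congr_deriv ?_
    simp [mul_comm]
  have deriv_b : HasDerivAt (fun s : ℝ => ((1 + a * s : ℝ) : ℂ)) a t := by
    simpa using (((hasDerivAt_id t).const_mul a).const_add 1).ofReal_comp
  have deriv_denom :=
    ((deriv_q.const_sub 1).mul_const (Complex.exp (-w))).const_sub 1
  refine ((deriv_q.fun_mul (deriv_b.mul_const w).fun_neg.cexp).mul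
    (deriv_denom.fun_inv denom_ne)).congr_deriv ?_
  simp only [yuleMixtureTimeDeriv, yuleMixture, geometricMixture]
  push_cast at denom_ne ⊢
  field_simp
  ring

/-- The Fourier transform of the equation of evolution, with `w` in place of `ψ(ξ)`. -/
theorem yuleMixtureTimeDeriv_eq (hq : |1 - Real.exp (-(rate * t))| < 1) (hw : 0 ≤ w.re) :
    yuleMixtureTimeDeriv a rate t w
      = a * (-w * yuleMixture a rate t w
          + rate * t * (yuleMixture a rate t w - Complex.exp (-w) * yuleMixture a rate t w))
        + rate * (yuleMixtureDeriv a rate t w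
          - Complex.exp (-w) * yuleMixtureDeriv a rate t w) := by
  have denom_ne := one_sub_mul_cexp_neg_ne_zero hq hw
  simp only [yuleMixtureTimeDeriv, yuleMixtureDeriv, geometricMixtureDeriv, yuleMixture,
    Complex.ofReal_add, Complex.ofReal_mul, Complex.ofReal_one]
  generalize geometricMixture _ _ w = G, ((Real.exp (-(rate * t)) : ℝ) : ℂ) = q,
    Complex.exp (-w) = z at denom_ne ⊢
  have inv_denom : (1 - (1 - q) * z)⁻¹ = 1 + (1 - q) * z * (1 - (1 - q) * z)⁻¹ := by
    field_simp
    ring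
  linear_combination -(rate * (1 - z) * G) * inv_denom

theorem norm_yuleMixtureTimeDeriv_le {κ β : ℝ} (hκ : 0 < κ)
    (hq : κ ≤ 1 - |1 - Real.exp (-(rate * t))|) (hβ : β ≤ 1 + a * t) (hw : 0 ≤ w.re) :
    ‖yuleMixtureTimeDeriv a rate t w‖
      ≤ (|a| * ‖w‖ + |rate| * (2 / κ)) * (2 / κ) * Real.exp (-(β * w.re)) := by
  have denom_le := hq.trans (one_sub_abs_le_norm_one_sub_mul_cexp_neg _ hw)
  have one_sub_le : ‖1 - Complex.exp (-w)‖ ≤ 2 := by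
    refine (norm_sub_le _ _).trans ?_
    have : ‖Complex.exp (-w)‖ ≤ 1 := by simpa [Complex.norm_exp] using hw
    rw [norm_one]
    linarith
  have mixture_le : ‖yuleMixture a rate t w‖ ≤ 2 / κ * Real.exp (-(β * w.re)) := by
    refine (norm_geometricMixture_le (by linarith) hw).trans ?_
    gcongr
  rw [yuleMixtureTimeDeriv, norm_mul, norm_neg, mul_assoc (|a| * ‖w‖ + _)]
  gcongr
  refine norm_add_le_of_le (by simp) ?_
  rw [norm_mul, norm_mul, norm_inv, Complex.norm_real, Real.norm_eq_abs, div_eq_mul_inv]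
  gcongr

end YuleMixture

namespace CoerciveSymbol

variable {ψ : ℝ → ℂ} (hψ : CoerciveSymbol ψ) {a rate t : ℝ}
include hψ

theorem rapidDecay_yuleMixtureTimeDeriv (hq : |1 - Real.exp (-(rate * t))| < 1)
    (hb : 0 < 1 + a * t) : RapidDecaySymbol (fun ξ => yuleMixtureTimeDeriv a rate t (ψ ξ)) := by
  have := ((SlowGrowthSymbol.const 1).add hψ.slowGrowth_cexp_neg.neg).mul
    (hψ.slowGrowth_inv_one_sub_mul_cexp_neg hq)
  convert (hψ.rapidDecay_geometricMixture hq hb).mul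
    (((hψ.const_mul a).add (this.const_mul rate)).neg) using 2 with ξ
  simp only [yuleMixtureTimeDeriv, yuleMixture, sub_eq_add_neg, Complex.ofReal_one]

theorem hasDerivAt_invFourierPos_yuleMixture (hq : |1 - Real.exp (-(rate * t))| < 1)
    (hb : 0 < 1 + a * t) (x : ℝ) :
    HasDerivAt (fun s => invFourierPos (fun ξ => yuleMixture a rate s (ψ ξ)) x)
      (invFourierPos (fun ξ => yuleMixtureTimeDeriv a rate t (ψ ξ)) x) t := by
  obtain ⟨κ, hκ, hκq⟩ := exists_between (sub_pos.mpr hq)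
  obtain ⟨β, hβ, hβb⟩ := exists_between hb
  have continuous_q : Continuous fun s => 1 - |1 - Real.exp (-(rate * s))| := by fun_prop
  have nhds_q : ∀ᶠ s in 𝓝 t, κ < 1 - |1 - Real.exp (-(rate * s))| :=
    continuous_q.continuousAt.eventually_const_lt hκq
  have nhds_b : ∀ᶠ s in 𝓝 t, β < 1 + a * s :=
    Continuous.continuousAt (by fun_prop) |>.eventually_const_lt hβb
  have integrable_bound : Integrable fun ξ =>
      (|a| * ‖ψ ξ‖ + |rate| * (2 / κ)) * (2 / κ) * Real.exp (-(β * (ψ ξ).re)) := by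
    have decay := hψ.rapidDecay_cexp_neg_mul hβ
    refine ((((decay.mul hψ.toSlowGrowthSymbol).integrable.norm.const_mul |a|).add
      (decay.integrable.norm.const_mul (|rate| * (2 / κ)))).const_mul (2 / κ)).congr
      (ae_of_all _ fun ξ => ?_)
    simp only [norm_mul, Complex.norm_exp, Complex.neg_re, Complex.re_ofReal_mul, Pi.add_apply]
    ring
  refine hasDerivAt_invFourierPos_of_dominated (nhds_q.and nhds_b) integrable_bound
    (fun s hs => (hψ.rapidDecay_geometricMixture (by linarith [hs.1]) (hβ.trans hs.2)).integrable)
    (hψ.rapidDecay_yuleMixtureTimeDeriv hq hb).differentiable.continuous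
    (fun ξ s hs => norm_yuleMixtureTimeDeriv_le hκ hs.1.le hs.2.le (hψ.re_nonneg ξ))
    (fun ξ s hs => hasDerivAt_yuleMixture (by linarith [hs.1]) (hψ.re_nonneg ξ)) x

end CoerciveSymbol

/-- The derivative of `ψ_{α,θ}`, for `1 < α`. -/
noncomputable def psiDeriv (α θ ξ : ℝ) : ℂ :=
  ((α * |ξ| ^ (α - 2) * ξ : ℝ) : ℂ) *
    Complex.exp (Complex.I * ((Real.sign ξ * θ * Real.pi / 2 : ℝ) : ℂ))

section PsiSymbol

variable {α : ℝ}

theorem norm_psiSymbol (α θ ξ : ℝ) : ‖psiSymbol α θ ξ‖ = |ξ| ^ α := by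
  rw [psiSymbol, norm_mul, Complex.norm_exp_I_mul_ofReal, Complex.norm_real, mul_one,
    Real.norm_of_nonneg (by positivity)]

theorem psiSymbol_neg (α θ ξ : ℝ) : psiSymbol α θ (-ξ) = starRingEnd ℂ (psiSymbol α θ ξ) := by
  rw [psiSymbol, psiSymbol, map_mul, Complex.conj_ofReal, abs_neg, ← Complex.exp_conj, map_mul,
    Complex.conj_I, Complex.conj_ofReal, Real.sign_neg]
  congr 2
  push_cast
  ring

theorem re_psiSymbol (hα : α ≠ 0) (θ ξ : ℝ) :
    (psiSymbol α θ ξ).re = |ξ| ^ α * Real.cos (θ * Real.pi / 2) := by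
  rw [psiSymbol, Complex.re_ofReal_mul, mul_comm Complex.I, Complex.exp_ofReal_mul_I_re]
  rcases lt_trichotomy ξ 0 with h | h | h
  · rw [Real.sign_of_neg h, ← Real.cos_neg]
    congr 2
    ring
  · simp [h, Real.zero_rpow hα]
  · rw [Real.sign_of_pos h, one_mul]

theorem psiSymbol_two_zero (ξ : ℝ) : psiSymbol 2 0 ξ = (ξ : ℂ) ^ 2 := by
  simp [psiSymbol]

theorem eventuallyEq_sign {ξ : ℝ} (hξ : ξ ≠ 0) : Real.sign =ᶠ[𝓝 ξ] fun _ => Real.sign ξ := by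
  rcases hξ.lt_or_gt with h | h
  · filter_upwards [gt_mem_nhds h] with y hy
    rw [Real.sign_of_neg hy, Real.sign_of_neg h]
  · filter_upwards [lt_mem_nhds h] with y hy
    rw [Real.sign_of_pos hy, Real.sign_of_pos h]

theorem hasDerivAt_psiSymbol (hα : 1 < α) (θ ξ : ℝ) :
    HasDerivAt (psiSymbol α θ) (psiDeriv α θ ξ) ξ := by
  rcases eq_or_ne ξ 0 with rfl | hξ
  · have hα0 : α ≠ 0 := by positivity
    have psiSymbol_zero : psiSymbol α θ 0 = 0 := by simp [psiSymbol, Real.zero_rpow hα0]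
    have psiDeriv_zero : psiDeriv α θ 0 = 0 := by simp [psiDeriv]
    rw [psiDeriv_zero, hasDerivAt_iff_isLittleO]
    simp only [psiSymbol_zero, sub_zero, smul_zero]
    refine Asymptotics.IsLittleO.of_norm_left ?_
    simp_rw [norm_psiSymbol]
    simpa [Real.zero_rpow hα0] using (hasDerivAt_abs_rpow 0 hα).isLittleO
  · refine (((hasDerivAt_abs_rpow ξ hα).ofReal_comp).mul_const
      (Complex.exp (Complex.I * ((Real.sign ξ * θ * Real.pi / 2 : ℝ) : ℂ)))).congr_of_eventuallyEq
      ?_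
    filter_upwards [eventuallyEq_sign hξ] with y hy
    rw [psiSymbol, hy]

theorem norm_psiDeriv (hα : 1 < α) (θ ξ : ℝ) : ‖psiDeriv α θ ξ‖ = α * |ξ| ^ (α - 1) := by
  rw [psiDeriv, norm_mul, Complex.norm_exp_I_mul_ofReal, Complex.norm_real, mul_one,
    Real.norm_eq_abs, abs_mul, abs_of_nonneg (by positivity), mul_assoc]
  rcases eq_or_ne ξ 0 with rfl | hξ
  · simp [Real.zero_rpow (sub_pos.mpr hα).ne']
  · rw [← Real.rpow_add_one (abs_ne_zero.mpr hξ)]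
    ring_nf

theorem abs_rpow_le_one_add_abs_pow {β : ℝ} {n : ℕ} (hβ : 0 ≤ β) (hn : β ≤ n) (ξ : ℝ) :
    |ξ| ^ β ≤ (1 + |ξ|) ^ n := by
  have := abs_nonneg ξ
  calc |ξ| ^ β ≤ (1 + |ξ|) ^ β := Real.rpow_le_rpow this (by linarith) hβ
    _ ≤ (1 + |ξ|) ^ (n : ℝ) := Real.rpow_le_rpow_of_exponent_le (by linarith) hn
    _ = (1 + |ξ|) ^ n := Real.rpow_natCast _ _

theorem abs_sub_one_le_abs_rpow (hα : 1 ≤ α) (ξ : ℝ) : |ξ| - 1 ≤ |ξ| ^ α := by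
  rcases le_total |ξ| 1 with h | h
  · exact (sub_nonpos.mpr h).trans (by positivity)
  · linarith [Real.self_le_rpow_of_one_le h hα]

theorem coerciveSymbol_psiSymbol (hα : 1 < α) {θ : ℝ} (hθ : 0 < Real.cos (θ * Real.pi / 2)) :
    CoerciveSymbol (psiSymbol α θ) where
  conj := psiSymbol_neg α θ
  differentiable ξ := (hasDerivAt_psiSymbol hα θ ξ).differentiableAt
  bound := by
    refine ⟨α, ⌈α⌉₊, fun ξ => ?_⟩
    rw [(hasDerivAt_psiSymbol hα θ ξ).deriv, norm_psiDeriv hα, norm_psiSymbol]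
    constructor
    · exact (abs_rpow_le_one_add_abs_pow (by linarith) (Nat.le_ceil α) ξ).trans
        (le_mul_of_one_le_left (by positivity) hα.le)
    · gcongr
      exact abs_rpow_le_one_add_abs_pow (by linarith) (by linarith [Nat.le_ceil α]) ξ
  re_nonneg ξ := by
    rw [re_psiSymbol (by positivity)]
    positivity
  coercive := by
    refine ⟨_, hθ, fun ξ => ?_⟩
    rw [re_psiSymbol (by positivity), mul_comm]
    gcongr
    exact abs_sub_one_le_abs_rpow hα.le ξ

end PsiSymbol

theorem coerciveSymbol_psiSymbol_two : CoerciveSymbol (psiSymbol 2 0) :=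
  coerciveSymbol_psiSymbol one_lt_two (by simp)

theorem hasDerivAt_sum_pow_div_factorial (N : ℕ) (z : ℂ) :
    HasDerivAt (fun z : ℂ => ∑ n ∈ Finset.range (N + 1), z ^ n / n.factorial)
      (∑ n ∈ Finset.range N, z ^ n / n.factorial) z := by
  have deriv_term (n : ℕ) :
      HasDerivAt (fun z : ℂ => z ^ (n + 1) / (n + 1).factorial) (z ^ n / n.factorial) z := by
    refine ((hasDerivAt_pow (n + 1) z).div_const _).congr_deriv ?_
    rw [Nat.factorial_succ, Nat.cast_mul,
      mul_div_mul_left _ _ (Nat.cast_ne_zero.mpr n.succ_ne_zero), Nat.add_sub_cancel]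
  simp only [Finset.sum_range_succ' _ N, pow_zero]
  exact (HasDerivAt.fun_sum fun n _ => deriv_term n).add_const _

/-- In the left half-plane the Taylor remainder of `exp` carries no exponential factor, as seen by
integrating the remainder of the previous order along the segment from `0`. -/
theorem norm_cexp_sub_sum_le (N : ℕ) {z : ℂ} (hz : z.re ≤ 0) :
    ‖Complex.exp z - ∑ n ∈ Finset.range N, z ^ n / n.factorial‖ ≤ ‖z‖ ^ N / N.factorial := by
  induction N generalizing z with
  | zero => simpa [Complex.norm_exp] using hz
  | succ N ih =>
    have deriv_remainder (s : ℝ) : HasDerivAt (fun s : ℝ => Complex.exp (s * z)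
        - ∑ n ∈ Finset.range (N + 1), (s * z) ^ n / n.factorial)
        ((Complex.exp (s * z) - ∑ n ∈ Finset.range N, (s * z) ^ n / n.factorial) * z) s := by
      have deriv_inner : HasDerivAt (fun s : ℝ => (s : ℂ) * z) z s := by
        simpa using Complex.ofRealCLM.hasDerivAt.mul_const z
      exact (((Complex.hasDerivAt_exp _).sub
        (hasDerivAt_sum_pow_div_factorial N _)).comp s deriv_inner)
    have deriv_bound (s : ℝ) :
        HasDerivAt (fun s : ℝ => s ^ (N + 1) * (‖z‖ ^ (N + 1) / (N + 1).factorial))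
          ((N + 1 : ℕ) * s ^ N * (‖z‖ ^ (N + 1) / (N + 1).factorial)) s :=
      (hasDerivAt_pow (N + 1) s).mul_const _
    simpa using image_norm_le_of_norm_deriv_right_le_deriv_boundary (a := 0) (b := 1) (x := 1)
      (fun s _ => (deriv_remainder s).continuousAt.continuousWithinAt)
      (fun s _ => (deriv_remainder s).hasDerivWithinAt) (by simp [Finset.sum_range_succ'])
      deriv_bound (fun s hs => by
        have re_nonpos : ((s : ℂ) * z).re ≤ 0 := by
          rw [Complex.re_ofReal_mul]
          exact mul_nonpos_of_nonneg_of_nonpos hs.1 hz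
        calc _ ≤ ‖(s : ℂ) * z‖ ^ N / N.factorial * ‖z‖ := by
              rw [norm_mul]
              gcongr
              exact ih re_nonpos
          _ = (N + 1 : ℕ) * s ^ N * (‖z‖ ^ (N + 1) / (N + 1).factorial) := by
              rw [norm_mul, Complex.norm_real, Real.norm_of_nonneg hs.1, Nat.factorial_succ]
              push_cast
              field_simp
              ring) (by simp)

theorem Gamma_add_div_factorial_le {s : ℝ} (h0 : 0 < s) (h1 : s < 1) {N : ℕ} (hN : 0 < N) :
    Real.Gamma (N + s) / N.factorial ≤ (N : ℝ) ^ (-(1 - s)) := by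
  have hN' : (0 : ℝ) < N := by exact_mod_cast hN
  have Gamma_pos : 0 < Real.Gamma (N + 1) := Real.Gamma_pos_of_pos (by positivity)
  have Gamma_eq : Real.Gamma N = Real.Gamma (N + 1) / N := by
    rw [Real.Gamma_add_one hN'.ne', mul_div_cancel_left₀ _ hN'.ne']
  have log_convex := Real.Gamma_mul_add_mul_le_rpow_Gamma_mul_rpow_Gamma hN'
    (show (0 : ℝ) < N + 1 by positivity) (show 0 < 1 - s by linarith) h0 (by ring)
  rw [show (1 - s) * N + s * (N + 1) = N + s by ring, Gamma_eq,
    Real.div_rpow Gamma_pos.le hN'.le, div_mul_eq_mul_div, ← Real.rpow_add Gamma_pos,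
    sub_add_cancel, Real.rpow_one, Real.Gamma_nat_eq_factorial] at log_convex
  rwa [div_le_iff₀ (by positivity), Real.rpow_neg hN'.le, inv_mul_eq_div]

theorem tendsto_Gamma_add_div_factorial {s : ℝ} (h0 : 0 < s) (h1 : s < 1) :
    Tendsto (fun N : ℕ => Real.Gamma (N + s) / N.factorial) atTop (𝓝 0) := by
  refine squeeze_zero' (Eventually.of_forall fun N => ?_) ?_
    ((tendsto_rpow_neg_atTop (sub_pos.mpr h1)).comp tendsto_natCast_atTop_atTop)
  · have := Real.Gamma_pos_of_pos (show (0 : ℝ) < N + s by positivity)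
    positivity
  · filter_upwards [eventually_gt_atTop 0] with N hN
    exact Gamma_add_div_factorial_le h0 h1 hN

theorem integral_abs_rpow_pow_mul_exp_neg {α : ℝ} (hα : 0 < α) (N : ℕ) :
    ∫ ξ : ℝ, (|ξ| ^ α) ^ N * Real.exp (-|ξ| ^ α) = 2 / α * Real.Gamma (N + 1 / α) := by
  rw [integral_comp_abs (f := fun r => (r ^ α) ^ N * Real.exp (-r ^ α))]
  have integral_half : ∫ r in Set.Ioi (0 : ℝ), (r ^ α) ^ N * Real.exp (-r ^ α)
      = 1 / α * Real.Gamma ((α * N + 1) / α) := by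
    rw [← integral_rpow_mul_exp_neg_rpow hα (neg_one_lt_zero.trans_le (by positivity))]
    refine setIntegral_congr_fun measurableSet_Ioi fun r hr => ?_
    rw [Real.rpow_mul (le_of_lt hr), Real.rpow_natCast]
  rw [integral_half, add_div, mul_div_cancel_left₀ _ hα.ne']
  ring

theorem integrable_abs_rpow_pow_mul_exp_neg {α : ℝ} (hα : 0 < α) (N : ℕ) :
    Integrable (fun ξ : ℝ => (|ξ| ^ α) ^ N * Real.exp (-|ξ| ^ α)) := by
  refine Integrable.of_integral_ne_zero ?_
  rw [integral_abs_rpow_pow_mul_exp_neg hα]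
  have := Real.Gamma_pos_of_pos (show (0 : ℝ) < N + 1 / α by positivity)
  positivity

theorem RapidDecaySymbol.abs_invFourierPos_cexp_mul_sub_sum_le {g m : ℝ → ℂ}
    (hg : RapidDecaySymbol g) (hm : SlowGrowthSymbol m) (hre : ∀ ξ, 0 ≤ (m ξ).re) (N : ℕ) (x : ℝ) :
    |invFourierPos (fun ξ => Complex.exp (-m ξ) * g ξ) x
      - ∑ n ∈ Finset.range N, 1 / (n.factorial : ℝ) * invFourierPos (fun ξ => (-m ξ) ^ n * g ξ) x|
      ≤ ∫ ξ, ‖m ξ‖ ^ N / N.factorial * ‖g ξ‖ := by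
  have integrable_term (n : ℕ) := (hg.mul (hm.neg.pow n)).integrable
  have integrable_exp := (hg.mul (hm.cexp_neg hre)).integrable
  have integrable_sum := integrable_finsetSum (Finset.range N) fun n _ =>
    (integrable_term n).const_mul ((1 / (n.factorial : ℝ) : ℝ) : ℂ)
  rw [← invFourierPos_sum _ _ _ integrable_term, ← invFourierPos_sub integrable_exp integrable_sum]
  refine (abs_invFourierPos_le _ _).trans ?_
  refine integral_mono_of_nonneg (ae_of_all _ fun ξ => norm_nonneg _) ?_ (ae_of_all _ fun ξ => ?_)
  · simpa only [norm_mul, norm_pow, mul_div_right_comm] using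
      (hg.mul (hm.pow N)).integrable.norm.div_const (N.factorial : ℝ)
  · have factor : Complex.exp (-m ξ) * g ξ
          - ∑ n ∈ Finset.range N, ((1 / (n.factorial : ℝ) : ℝ) : ℂ) * ((-m ξ) ^ n * g ξ)
        = (Complex.exp (-m ξ) - ∑ n ∈ Finset.range N, (-m ξ) ^ n / n.factorial) * g ξ := by
      rw [sub_mul, Finset.sum_mul]
      congr 1
      refine Finset.sum_congr rfl fun n _ => ?_
      push_cast
      ring
    simp only [factor, norm_mul]
    gcongr
    simpa using norm_cexp_sub_sum_le N (z := -m ξ) (by simpa using hre ξ)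

/-- The `N`-th remainder is at most a multiple of `Γ(N + 1/α) / N!`, hence of `N ^ (1/α - 1)`. -/
theorem RapidDecaySymbol.tendstoUniformly_exp_series {α θ : ℝ} (hα : 1 < α)
    (hθ : 0 < Real.cos (θ * Real.pi / 2)) {g : ℝ → ℂ} (hg : RapidDecaySymbol g) {K : ℝ}
    (hK : ∀ ξ, ‖g ξ‖ ≤ K * Real.exp (-|ξ| ^ α)) :
    TendstoUniformly (fun (N : ℕ) (x : ℝ) => ∑ n ∈ Finset.range N, 1 / (n.factorial : ℝ) *
        invFourierPos (fun ξ => (-psiSymbol α θ ξ) ^ n * g ξ) x)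
      (invFourierPos fun ξ => Complex.exp (-psiSymbol α θ ξ) * g ξ) atTop := by
  have hα0 : 0 < α := by linarith
  have hψ := coerciveSymbol_psiSymbol hα hθ
  have remainder_le (N : ℕ) (x : ℝ) :
      |invFourierPos (fun ξ => Complex.exp (-psiSymbol α θ ξ) * g ξ) x
        - ∑ n ∈ Finset.range N, 1 / (n.factorial : ℝ) *
          invFourierPos (fun ξ => (-psiSymbol α θ ξ) ^ n * g ξ) x|
        ≤ K * (2 / α) * (Real.Gamma (N + 1 / α) / N.factorial) := by
    calc _ ≤ ∫ ξ, ‖psiSymbol α θ ξ‖ ^ N / N.factorial * ‖g ξ‖ :=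
          hg.abs_invFourierPos_cexp_mul_sub_sum_le hψ.toSlowGrowthSymbol hψ.re_nonneg N x
      _ ≤ ∫ ξ : ℝ, K / N.factorial * ((|ξ| ^ α) ^ N * Real.exp (-|ξ| ^ α)) := by
          refine integral_mono_of_nonneg (ae_of_all _ fun ξ => by positivity)
            ((integrable_abs_rpow_pow_mul_exp_neg hα0 N).const_mul _) (ae_of_all _ fun ξ => ?_)
          simp only [norm_psiSymbol]
          calc (|ξ| ^ α) ^ N / N.factorial * ‖g ξ‖
              ≤ (|ξ| ^ α) ^ N / N.factorial * (K * Real.exp (-|ξ| ^ α)) := by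
                gcongr
                exact hK ξ
            _ = K / N.factorial * ((|ξ| ^ α) ^ N * Real.exp (-|ξ| ^ α)) := by ring
      _ = K * (2 / α) * (Real.Gamma (N + 1 / α) / N.factorial) := by
          rw [integral_const_mul, integral_abs_rpow_pow_mul_exp_neg hα0]
          ring
  have tendsto_bound := (tendsto_Gamma_add_div_factorial (s := 1 / α) (by positivity)
    ((div_lt_one hα0).mpr hα)).const_mul (K * (2 / α))
  rw [mul_zero] at tendsto_bound
  rw [Metric.tendstoUniformly_iff]
  intro ε hε
  filter_upwards [tendsto_bound.eventually_lt_const hε] with N hN x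
  rw [Real.dist_eq]
  exact (remainder_le N x).trans_lt hN

section Density

variable {ν : Measure ℝ}

theorem integrable_exp_mul_ofReal {f : ℝ → ℝ} (hf : Integrable f) (ξ : ℝ) :
    Integrable (fun x : ℝ => Complex.exp (Complex.I * ξ * x) * (f x : ℂ)) :=
  (hf.ofReal (𝕜 := ℂ)).bdd_mul (c := 1) (by fun_prop)
    (ae_of_all _ fun x => by simp [Complex.norm_exp])

theorem fourierPos_add {f g : ℝ → ℝ} (hf : Integrable f) (hg : Integrable g) (ξ : ℝ) :
    fourierPos (fun x => f x + g x) ξ = fourierPos f ξ + fourierPos g ξ := by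
  simp only [fourierPos, Complex.ofReal_add, mul_add]
  exact integral_add (integrable_exp_mul_ofReal hf ξ) (integrable_exp_mul_ofReal hg ξ)

theorem charFun_withDensity_ofReal {f : ℝ → ℝ} (hf : Measurable f) (ξ : ℝ) :
    charFun (volume.withDensity fun x => ENNReal.ofReal (f x)) ξ
      = fourierPos (fun x => max (f x) 0) ξ := by
  rw [charFun_apply_real, integral_withDensity_eq_integral_toReal_smul hf.ennreal_ofReal
    (by simp), fourierPos]
  congr 1 with x
  rw [ENNReal.toReal_ofReal', Complex.real_smul, mul_comm]
  congr 2
  ring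

theorem charFun_add_measure (ν ρ : Measure ℝ) [IsFiniteMeasure ν] [IsFiniteMeasure ρ] (ξ : ℝ) :
    charFun (ν + ρ) ξ = charFun ν ξ + charFun ρ ξ := by
  have integrable_exp (m : Measure ℝ) [IsFiniteMeasure m] :
      Integrable (fun x : ℝ => Complex.exp (ξ * x * Complex.I)) m :=
    (integrable_const (1 : ℝ)).mono' (by fun_prop) (ae_of_all _ fun x => by simp [Complex.norm_exp])
  simp only [charFun_apply_real]
  exact integral_add_measure (integrable_exp ν) (integrable_exp ρ)

theorem add_withDensity_neg_eq_of_charFun [IsFiniteMeasure ν] {u : ℝ → ℝ} (hm : Measurable u)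
    (hi : Integrable u) (h : ∀ ξ, charFun ν ξ = fourierPos u ξ) :
    ν + volume.withDensity (fun x => ENNReal.ofReal (-u x))
      = volume.withDensity (fun x => ENNReal.ofReal (u x)) := by
  have := isFiniteMeasure_withDensity_ofReal hi.2
  have := isFiniteMeasure_withDensity_ofReal hi.neg.2
  have integrable_negPart : Integrable fun x => max (-u x) 0 := hi.neg.pos_part
  refine Measure.ext_of_charFun (funext fun ξ => ?_)
  rw [charFun_add_measure, h, charFun_withDensity_ofReal hm, charFun_withDensity_ofReal hm.fun_neg,
    ← fourierPos_add hi integrable_negPart]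
  congr 1 with x
  simp only [max_def]
  split_ifs <;> linarith

theorem nonneg_of_withDensity_neg_le {u : ℝ → ℝ} (hc : Continuous u)
    (h : volume.withDensity (fun x => ENNReal.ofReal (-u x))
      ≤ volume.withDensity fun x => ENNReal.ofReal (u x)) (x : ℝ) : 0 ≤ u x := by
  have ofReal_le : (fun x => ENNReal.ofReal (-u x)) ≤ᵐ[volume] fun x => ENNReal.ofReal (u x) :=
    ae_le_of_forall_setLIntegral_le_of_sigmaFinite hc.measurable.neg.ennreal_ofReal
      fun s hs _ => by simpa only [withDensity_apply _ hs] using h s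
  have abs_eq : u = fun x => |u x| := by
    refine (Continuous.ae_eq_iff_eq volume hc hc.abs).mp ?_
    filter_upwards [ofReal_le] with x hx
    rcases le_or_gt 0 (u x) with hu | hu
    · rw [abs_of_nonneg hu]
    · rw [ENNReal.ofReal_of_nonpos hu.le, nonpos_iff_eq_zero, ENNReal.ofReal_eq_zero] at hx
      linarith
  rw [abs_eq]
  exact abs_nonneg _

theorem isContinuousDensity_of_charFun [IsFiniteMeasure ν] {u : ℝ → ℝ} (hc : Continuous u)
    (hi : Integrable u) (h : ∀ ξ, charFun ν ξ = fourierPos u ξ) : IsContinuousDensity ν u := by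
  have add_eq := add_withDensity_neg_eq_of_charFun hc.measurable hi h
  have nonneg := nonneg_of_withDensity_neg_le hc (add_eq ▸ Measure.le_add_left le_rfl)
  have negPart_eq_zero : (fun x => ENNReal.ofReal (-u x)) = 0 := by
    ext x
    simp [nonneg x]
  refine ⟨hc, nonneg, ?_⟩
  rw [← add_eq, negPart_eq_zero, withDensity_zero, add_zero]

theorem IsContinuousDensity.unique {f g : ℝ → ℝ} (hf : IsContinuousDensity ν f)
    (hg : IsContinuousDensity ν g) : f = g := by
  have ae_eq := hf.eq_withDensity.symm.trans hg.eq_withDensity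
  rw [withDensity_eq_iff_of_sigmaFinite hf.continuous.measurable.ennreal_ofReal.aemeasurable
    hg.continuous.measurable.ennreal_ofReal.aemeasurable] at ae_eq
  refine (Continuous.ae_eq_iff_eq volume hf.continuous hg.continuous).mp ?_
  filter_upwards [ae_eq] with x hx
  exact (ENNReal.ofReal_eq_ofReal_iff (hf.nonneg x) (hg.nonneg x)).mp hx

theorem IsContinuousDensity.integrable_mul {u : ℝ → ℝ} (hu : IsContinuousDensity ν u)
    (h : Integrable (fun x => x) ν) : Integrable (fun x => x * u x) := by
  rw [hu.eq_withDensity, integrable_withDensity_iff hu.continuous.measurable.ennreal_ofReal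
    (by simp)] at h
  simpa [ENNReal.toReal_ofReal (hu.nonneg _)] using h

end Density

section Moment

variable {ν : Measure ℝ} [IsProbabilityMeasure ν] {α C : ℝ}

theorem measureReal_abs_gt_le_of_charFun (hα : 0 < α) (h : ∀ ξ, ‖1 - charFun ν ξ‖ ≤ C * |ξ| ^ α)
    {r : ℝ} (hr : 0 < r) : ν.real {x | r < |x|} ≤ 2 * C * 2 ^ α * r ^ (-α) := by
  have hC : 0 ≤ C := by simpa using (norm_nonneg _).trans (h 1)
  have r_inv_pos : 0 < r⁻¹ := inv_pos.mpr hr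
  have integral_le : ‖∫ t in (-2 * r⁻¹)..(2 * r⁻¹), 1 - charFun ν t‖
      ≤ C * (2 * r⁻¹) ^ α * |2 * r⁻¹ - -2 * r⁻¹| := by
    refine intervalIntegral.norm_integral_le_of_norm_le_const fun t ht => (h t).trans ?_
    rw [Set.uIoc_of_le (by linarith)] at ht
    have : |t| ≤ 2 * r⁻¹ := abs_le.mpr ⟨by linarith [ht.1], ht.2⟩
    gcongr
  calc ν.real {x | r < |x|}
      ≤ 2⁻¹ * r * ‖∫ t in (-2 * r⁻¹)..(2 * r⁻¹), 1 - charFun ν t‖ :=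
        measureReal_abs_gt_le_integral_charFun hr
    _ ≤ 2⁻¹ * r * (C * (2 * r⁻¹) ^ α * |2 * r⁻¹ - -2 * r⁻¹|) := by gcongr
    _ = 2 * C * 2 ^ α * r ^ (-α) := by
        rw [Real.mul_rpow (by norm_num) (by positivity), Real.rpow_neg hr.le,
          Real.inv_rpow hr.le, abs_of_pos (by linarith)]
        field_simp
        ring

theorem integrable_id_of_charFun (hα : 1 < α) (h : ∀ ξ, ‖1 - charFun ν ξ‖ ≤ C * |ξ| ^ α) :
    Integrable (fun x => x) ν := by
  refine ⟨by fun_prop, ?_⟩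
  rw [hasFiniteIntegral_iff_norm]
  simp only [Real.norm_eq_abs]
  rw [lintegral_eq_lintegral_meas_lt ν (ae_of_all _ abs_nonneg) (by fun_prop),
    ← Set.Ioc_union_Ioi_eq_Ioi zero_le_one]
  refine (lintegral_union_le _ _ _).trans_lt (ENNReal.add_lt_top.mpr ⟨?_, ?_⟩)
  · calc _ ≤ ∫⁻ _ in Set.Ioc (0 : ℝ) 1, 1 := lintegral_mono fun _ => prob_le_one
      _ < ∞ := by simp
  · have integrable_tail := (integrableOn_Ioi_rpow_of_lt (neg_lt_neg hα) zero_lt_one).const_mul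
      (2 * C * 2 ^ α)
    refine (setLIntegral_mono' measurableSet_Ioi fun r hr => ?_).trans_lt
      (IntegrableOn.setLIntegral_lt_top integrable_tail)
    rw [← ofReal_measureReal]
    exact ENNReal.ofReal_le_ofReal
      (measureReal_abs_gt_le_of_charFun (by linarith) h (zero_lt_one.trans hr))

end Moment

/-- The distribution function of the time of the `n`-th birth in a Yule process. It is the
distribution function of the maximum of `n` independent exponential variables. -/
noncomputable def birthTimeCDF (rate : ℝ) (n : ℕ) (t : ℝ) : ℝ≥0∞ :=
  if 0 ≤ t then ENNReal.ofReal ((1 - Real.exp (-(rate * t))) ^ n) else 0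

section BirthTime

variable {rate : ℝ}

theorem measurable_birthTimeCDF (rate : ℝ) (n : ℕ) : Measurable (birthTimeCDF rate n) :=
  Measurable.ite measurableSet_Ici (by fun_prop) measurable_const

theorem integral_exp_mul_one_sub_exp_pow (rate t : ℝ) (n : ℕ) :
    ∫ y in (0 : ℝ)..t, rate * (n + 1) * Real.exp (-(rate * (n + 1) * y)) *
      (1 - Real.exp (-(rate * (t - y)))) ^ n = (1 - Real.exp (-(rate * t))) ^ (n + 1) := by
  have deriv_primitive (y : ℝ) : HasDerivAt
      (fun y => -(Real.exp (-(rate * y)) - Real.exp (-(rate * t))) ^ (n + 1))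
      (rate * (n + 1) * Real.exp (-(rate * (n + 1) * y)) *
        (1 - Real.exp (-(rate * (t - y)))) ^ n) y := by
    refine ((((((hasDerivAt_id y).const_mul rate).fun_neg.exp).sub_const
      (Real.exp (-(rate * t)))).fun_pow (n + 1)).fun_neg).congr_deriv ?_
    have exp_pow : Real.exp (-(rate * (n + 1) * y)) = Real.exp (-(rate * y)) ^ (n + 1) := by
      rw [← Real.exp_nat_mul]
      push_cast
      ring_nf
    have factor : Real.exp (-(rate * y)) - Real.exp (-(rate * t))
        = Real.exp (-(rate * y)) * (1 - Real.exp (-(rate * (t - y)))) := by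
      rw [mul_sub, ← Real.exp_add]
      ring_nf
    simp only [id, Nat.add_sub_cancel, factor, exp_pow, mul_pow, pow_succ]
    push_cast
    ring
  rw [intervalIntegral.integral_eq_sub_of_hasDerivAt (fun y _ => deriv_primitive y)
    (Continuous.intervalIntegrable (by fun_prop) _ _)]
  simp

theorem exponentialPDF_mul_birthTimeCDF (hrate : 0 < rate) (n : ℕ) (t y : ℝ) :
    exponentialPDF (rate * (n + 1)) y * birthTimeCDF rate n (t - y)
      = (Set.Icc 0 t).indicator (fun y => ENNReal.ofReal
        (rate * (n + 1) * Real.exp (-(rate * (n + 1) * y)) *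
          (1 - Real.exp (-(rate * (t - y)))) ^ n)) y := by
  rw [birthTimeCDF]
  rcases lt_or_ge y 0 with hy | hy
  · rw [Set.indicator_of_notMem (fun h => hy.not_ge h.1), exponentialPDF_of_neg hy, zero_mul]
  rcases lt_or_ge t y with hyt | hyt
  · rw [Set.indicator_of_notMem (fun h => hyt.not_ge h.2), if_neg (by linarith), mul_zero]
  · rw [Set.indicator_of_mem (Set.mem_Icc.mpr ⟨hy, hyt⟩), if_pos (by linarith),
      exponentialPDF_of_nonneg hy, ← ENNReal.ofReal_mul (by positivity)]

theorem lintegral_birthTimeCDF_expMeasure (hrate : 0 < rate) (n : ℕ) (t : ℝ) :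
    ∫⁻ y, birthTimeCDF rate n (t - y) ∂expMeasure (rate * (n + 1))
      = birthTimeCDF rate (n + 1) t := by
  have expMeasure_eq : expMeasure (rate * (n + 1))
      = volume.withDensity (exponentialPDF (rate * (n + 1))) := rfl
  have measurable_pdf : Measurable (exponentialPDF (rate * (n + 1))) :=
    (measurable_exponentialPDFReal _).ennreal_ofReal
  have measurable_cdf : Measurable fun y => birthTimeCDF rate n (t - y) :=
    (measurable_birthTimeCDF rate n).comp (by fun_prop)
  rw [expMeasure_eq, lintegral_withDensity_eq_lintegral_mul _ measurable_pdf measurable_cdf]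
  simp only [Pi.mul_apply, exponentialPDF_mul_birthTimeCDF hrate]
  rw [lintegral_indicator measurableSet_Icc, birthTimeCDF]
  split_ifs with ht
  · rw [← integral_exp_mul_one_sub_exp_pow, intervalIntegral.integral_of_le ht,
      ← integral_Icc_eq_integral_Ioc, ofReal_integral_eq_lintegral_ofReal]
    · exact Continuous.integrableOn_Icc (by fun_prop)
    · refine (ae_restrict_iff' measurableSet_Icc).mpr (ae_of_all _ fun y hy => ?_)
      have : 0 ≤ 1 - Real.exp (-(rate * (t - y))) :=
        sub_nonneg.mpr (Real.exp_le_one_iff.mpr (by nlinarith [hy.2]))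
      simp only [Pi.zero_apply]
      positivity
  · rw [Set.Icc_eq_empty ht, Measure.restrict_empty, lintegral_zero_measure]

variable {Ω : Type*} [MeasurableSpace Ω] {μ : Measure Ω}

theorem measure_add_le_of_indepFun [IsFiniteMeasure μ] {X Y : Ω → ℝ} (hX : Measurable X)
    (hY : Measurable Y) (hXY : IndepFun X Y μ) (t : ℝ) :
    μ {ω | X ω + Y ω ≤ t} = ∫⁻ y, μ {ω | X ω ≤ t - y} ∂μ.map Y := by
  have measurableSet_add_le : MeasurableSet {p : ℝ × ℝ | p.1 + p.2 ≤ t} :=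
    measurableSet_le (by fun_prop) (by fun_prop)
  calc μ {ω | X ω + Y ω ≤ t}
      = μ.map (fun ω => (X ω, Y ω)) {p : ℝ × ℝ | p.1 + p.2 ≤ t} :=
        (Measure.map_apply (hX.prodMk hY) measurableSet_add_le).symm
    _ = ∫⁻ y, μ.map X ((fun x => (x, y)) ⁻¹' {p : ℝ × ℝ | p.1 + p.2 ≤ t}) ∂μ.map Y := by
        rw [(indepFun_iff_map_prod_eq_prod_map_map hX.aemeasurable hY.aemeasurable).mp hXY,
          Measure.prod_apply_symm measurableSet_add_le]
    _ = ∫⁻ y, μ {ω | X ω ≤ t - y} ∂μ.map Y := by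
        refine lintegral_congr fun y => ?_
        rw [Measure.map_apply hX (measurable_prodMk_right measurableSet_add_le)]
        simp only [Set.preimage_ofPred_eq, le_sub_iff_add_le]

theorem measure_sum_exponential_le [IsProbabilityMeasure μ] (hrate : 0 < rate) {T : ℕ → Ω → ℝ}
    (hm : ∀ n, Measurable (T n)) (hind : iIndepFun T μ)
    (hlaw : ∀ n : ℕ, μ.map (T n) = expMeasure (rate * (n + 1))) (n : ℕ) (t : ℝ) :
    μ {ω | ∑ i ∈ Finset.range n, T i ω ≤ t} = birthTimeCDF rate n t := by
  induction n generalizing t with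
  | zero => by_cases h : 0 ≤ t <;> simp [birthTimeCDF, h]
  | succ n ih =>
    have indep_last : IndepFun (fun ω => ∑ i ∈ Finset.range n, T i ω) (T n) μ := by
      convert! hind.indepFun_finsetSum_of_notMem hm Finset.notMem_range_self using 1
      ext ω
      simp
    simp_rw [Finset.sum_range_succ, measure_add_le_of_indepFun (by fun_prop) (hm n) indep_last, ih,
      hlaw, lintegral_birthTimeCDF_expMeasure hrate]

end BirthTime

namespace IsYuleProcess

variable {Ω : Type*} [MeasurableSpace Ω] {μ : Measure Ω} [IsProbabilityMeasure μ] {rate : ℝ}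
  {B : ℝ≥0 → Ω → ℕ}

theorem measureReal_lt (hB : IsYuleProcess rate B μ) (hrate : 0 < rate) (t : ℝ≥0) (n : ℕ) :
    μ.real {ω | n < B t ω} = (1 - Real.exp (-(rate * t))) ^ n := by
  obtain ⟨T, hm, hind, hlaw, hT⟩ := hB.holding
  have lt_iff : μ {ω | n < B t ω} = μ {ω | ∑ i ∈ Finset.range n, T i ω ≤ (t : ℝ)} :=
    measure_congr (by filter_upwards [hT] with ω hω using propext (hω t n))
  have : 0 ≤ 1 - Real.exp (-(rate * t)) := by
    rw [sub_nonneg, Real.exp_le_one_iff, neg_nonpos]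
    positivity
  rw [measureReal_def, lt_iff, measure_sum_exponential_le hrate hm hind hlaw, birthTimeCDF,
    if_pos t.coe_nonneg, ENNReal.toReal_ofReal (by positivity)]

end IsYuleProcess

/-- The one-dimensional laws of a Lévy process with characteristic exponent `ψ`; nothing is
required of the joint laws of `S`. -/
structure HasCharExponent {Ω : Type*} [MeasurableSpace Ω] (ψ : ℝ → ℂ) (S : ℝ≥0 → Ω → ℝ)
    (μ : Measure Ω) : Prop where
  measurable : ∀ t, Measurable (S t)
  charFun_map : ∀ (t : ℝ≥0) (ξ : ℝ),
    charFun (μ.map (S t)) ξ = Complex.exp (-(((t : ℝ) : ℂ) * ψ ξ))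

/-- The one-dimensional laws of a Yule process: `B t` is geometric with parameter `e^{-rate t}` on
`{1, 2, …}`. Nothing is required of the joint laws of `B`. -/
structure HasYuleMarginals {Ω : Type*} [MeasurableSpace Ω] (rate : ℝ) (B : ℝ≥0 → Ω → ℕ)
    (μ : Measure Ω) : Prop where
  measurable : ∀ t, Measurable (B t)
  measureReal_lt : ∀ (t : ℝ≥0) (n : ℕ),
    μ.real {ω | n < B t ω} = (1 - Real.exp (-(rate * t))) ^ n

section Marginals

variable {Ω : Type*} [MeasurableSpace Ω] {μ : Measure Ω}

theorem IsStableProcess.hasCharExponent {α θ : ℝ} {S : ℝ≥0 → Ω → ℝ}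
    (hS : IsStableProcess α θ S μ) : HasCharExponent (psiSymbol α θ) S μ where
  measurable := hS.measurable
  charFun_map t ξ := by
    have sub_zero_ae : (fun ω => S t ω - S 0 ω) =ᵐ[μ] S t := by
      filter_upwards [hS.zero] with ω hω
      rw [hω, sub_zero]
    rw [← Measure.map_congr sub_zero_ae, hS.charFun_increment 0 t zero_le]
    simp

theorem IsYuleProcess.hasYuleMarginals [IsProbabilityMeasure μ] {rate : ℝ} {B : ℝ≥0 → Ω → ℕ}
    (hB : IsYuleProcess rate B μ) (hrate : 0 < rate) : HasYuleMarginals rate B μ where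
  measurable := hB.measurable
  measureReal_lt := hB.measureReal_lt hrate

namespace HasYuleMarginals

variable [IsProbabilityMeasure μ] {rate : ℝ} {B : ℝ≥0 → Ω → ℕ}

theorem measureReal_eq_zero (hB : HasYuleMarginals rate B μ) (t : ℝ≥0) :
    μ.real {ω | B t ω = 0} = 0 := by
  have eq_compl : {ω | B t ω = 0} = {ω | 0 < B t ω}ᶜ := by
    ext ω
    simp
  rw [eq_compl, probReal_compl_eq_one_sub (measurableSet_lt measurable_const (hB.measurable t)),
    hB.measureReal_lt, pow_zero, sub_self]

theorem measureReal_eq_succ (hB : HasYuleMarginals rate B μ) (t : ℝ≥0) (n : ℕ) :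
    μ.real {ω | B t ω = n + 1} = Real.exp (-(rate * t)) * (1 - Real.exp (-(rate * t))) ^ n := by
  have measurableSet_gt : MeasurableSet {ω | n + 1 < B t ω} :=
    measurableSet_lt measurable_const (hB.measurable t)
  have eq_sdiff : {ω | B t ω = n + 1} = {ω | n < B t ω} \ {ω | n + 1 < B t ω} := by
    ext ω
    simp only [Set.mem_ofPred_eq, Set.mem_sdiff]
    lia
  have subset : {ω | n + 1 < B t ω} ⊆ {ω | n < B t ω} := fun ω hω => n.lt_succ_self.trans hω
  rw [eq_sdiff, measureReal_sdiff subset measurableSet_gt, hB.measureReal_lt, hB.measureReal_lt]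
  ring

end HasYuleMarginals

section RandomTime

variable {X : ℕ → Ω → ℝ} {N : Ω → ℕ}

theorem measurable_randomTime (hX : ∀ k, Measurable (X k)) (hN : Measurable N) :
    Measurable fun ω => X (N ω) ω := by
  have : Measurable (fun p : Ω × ℕ => X p.2 p.1) := measurable_from_prod_countable_left hX
  exact this.comp (measurable_id.prodMk hN)

theorem hasSum_charFun_randomTime [IsFiniteMeasure μ] (hX : ∀ k, Measurable (X k))
    (hN : Measurable N) (h : ∀ k, IndepFun (X k) N μ) (ξ : ℝ) :
    HasSum (fun k => (μ.real {ω | N ω = k} : ℂ) * charFun (μ.map (X k)) ξ)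
      (charFun (μ.map fun ω => X (N ω) ω) ξ) := by
  have measurable_XN := measurable_randomTime hX hN
  have charFun_eq {Y : Ω → ℝ} (hY : Measurable Y) :
      charFun (μ.map Y) ξ = ∫ ω, Complex.exp (ξ * Y ω * Complex.I) ∂μ := by
    rw [charFun_apply_real, integral_map hY.aemeasurable (by fun_prop)]
  have measurable_exp : Measurable fun x : ℝ => Complex.exp (ξ * x * Complex.I) := by fun_prop
  have integrable_exp : Integrable (fun ω => Complex.exp (ξ * X (N ω) ω * Complex.I)) μ :=
    (integrable_const (1 : ℝ)).mono' (measurable_exp.comp measurable_XN).aestronglyMeasurable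
      (ae_of_all _ fun ω => by simp [Complex.norm_exp])
  have iUnion_fibers : ⋃ k, N ⁻¹' {k} = Set.univ := by
    ext ω
    simp
  have hasSum_fibers := hasSum_integral_iUnion (μ := μ)
    (fun k => hN (measurableSet_singleton k))
    (fun i j hij => (Set.disjoint_singleton.mpr hij).preimage N)
    (integrable_exp.integrableOn (s := ⋃ k, N ⁻¹' {k}))
  rw [iUnion_fibers, setIntegral_univ, ← charFun_eq measurable_XN] at hasSum_fibers
  convert! hasSum_fibers using 2 with k
  have on_fiber : ∫ ω in N ⁻¹' {k}, Complex.exp (ξ * X (N ω) ω * Complex.I) ∂μ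
      = ∫ ω in N ⁻¹' {k}, Complex.exp (ξ * X k ω * Complex.I) ∂μ :=
    setIntegral_congr_fun (hN (measurableSet_singleton k)) fun ω (hω : N ω = k) => by
      simp only [hω]
  rw [on_fiber, Indep.setIntegral_eq_smul hN.comap_le (h k).symm (hX k).aemeasurable
    ⟨{k}, measurableSet_singleton k, rfl⟩ measurable_exp.aestronglyMeasurable, charFun_eq (hX k),
    Complex.real_smul]
  rfl

end RandomTime

theorem charFun_subordinated_yule [IsProbabilityMeasure μ] {ψ : ℝ → ℂ} {S : ℝ≥0 → Ω → ℝ}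
    {rate : ℝ} {B : ℝ≥0 → Ω → ℕ} (hS : HasCharExponent ψ S μ) (hψ : ∀ ξ, 0 ≤ (ψ ξ).re)
    (hB : HasYuleMarginals rate B μ) (hrate : 0 ≤ rate)
    (hSB : ∀ s t, IndepFun (S s) (B t) μ) (a t : ℝ≥0) (ξ : ℝ) :
    charFun (μ.map fun ω => S (a * t + (B t ω : ℝ≥0)) ω) ξ = yuleMixture a rate t (ψ ξ) := by
  have hasSum_values := hasSum_charFun_randomTime
    (X := fun k => S (a * t + k)) (fun k => hS.measurable _) (hB.measurable t)
    (fun k => hSB _ t) ξ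
  have hasSum_mixture := hasSum_geometricMixture (1 + a * t)
    (abs_one_sub_exp_neg_lt_one (mul_nonneg hrate t.coe_nonneg)) (hψ ξ)
  refine hasSum_values.unique ((hasSum_nat_add_iff' 1).mp ?_)
  simp only [yuleMixture, Finset.sum_range_one, hB.measureReal_eq_zero, Complex.ofReal_zero,
    zero_mul, sub_zero, hB.measureReal_eq_succ, hS.charFun_map]
  convert! hasSum_mixture using 6
  push_cast
  ring

end Marginals

namespace RapidDecaySymbol

variable {g : ℝ → ℂ}

section RieszFeller

variable {α θ : ℝ} (hα : 1 < α) (hθ : 0 < Real.cos (θ * Real.pi / 2)) (hg : RapidDecaySymbol g)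
include hα hθ hg

theorem isRieszFeller_invFourierPos :
    IsRieszFeller α θ (invFourierPos g) (invFourierPos fun ξ => -psiSymbol α θ ξ * g ξ) :=
  hg.isFourierMultiplier (coerciveSymbol_psiSymbol hα hθ).neg

theorem isRieszFellerIterates_invFourierPos :
    IsRieszFellerIterates α θ (invFourierPos g)
      (fun n => invFourierPos fun ξ => (-psiSymbol α θ ξ) ^ n * g ξ) := by
  refine ⟨by simp, fun n => ?_⟩
  simpa only [← mul_assoc, ← pow_succ'] using isRieszFeller_invFourierPos hα hθ
    (hg.mul ((coerciveSymbol_psiSymbol hα hθ).neg.pow n))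

theorem isFractionalShift_invFourierPos :
    IsFractionalShift α θ 1 (invFourierPos g)
      (invFourierPos fun ξ => Complex.exp (-psiSymbol α θ ξ) * g ξ) := by
  have hψ := coerciveSymbol_psiSymbol hα hθ
  have exp_mul_decay := hg.mul hψ.slowGrowth_cexp_neg
  refine ⟨_, isRieszFellerIterates_invFourierPos hα hθ hg, exp_mul_decay.integrable_invFourierPos,
    exp_mul_decay.continuous_invFourierPos, fun ξ => ?_⟩
  simp only [exp_mul_decay.fourierPos_invFourierPos,
    fun n => (hg.mul (hψ.neg.pow n)).fourierPos_invFourierPos ξ]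
  have hasSum_exp := (NormedSpace.expSeries_div_hasSum_exp (-psiSymbol α θ ξ)).mul_right (g ξ)
  rw [← Complex.exp_eq_exp_ℂ] at hasSum_exp
  convert! hasSum_exp using 2 with n
  push_cast
  ring

variable {b K : ℝ} (hK : ∀ ξ, ‖g ξ‖ ≤ K * Real.exp (-(b * (psiSymbol α θ ξ).re)))
  (hb : 1 ≤ b * Real.cos (θ * Real.pi / 2))
include hK hb

omit hθ hg in
theorem norm_le_mul_exp_neg_abs_rpow (ξ : ℝ) : ‖g ξ‖ ≤ K * Real.exp (-|ξ| ^ α) := by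
  have hα0 : α ≠ 0 := by positivity
  have K_nonneg : 0 ≤ K := by
    simpa [psiSymbol, hα0] using (norm_nonneg _).trans (hK 0)
  refine (hK ξ).trans ?_
  rw [re_psiSymbol hα0, mul_left_comm]
  gcongr
  exact le_mul_of_one_le_right (by positivity) hb

theorem isUniformFractionalShift_invFourierPos :
    IsUniformFractionalShift α θ 1 (invFourierPos g)
      (invFourierPos fun ξ => Complex.exp (-psiSymbol α θ ξ) * g ξ) :=
  ⟨_, isRieszFellerIterates_invFourierPos hα hθ hg, by
    simpa only [one_pow] using
      tendstoUniformly_exp_series hα hθ hg (norm_le_mul_exp_neg_abs_rpow hα hK hb)⟩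

end RieszFeller

theorem iteratedDeriv_two_mul_invFourierPos (hg : RapidDecaySymbol g) (n : ℕ) :
    iteratedDeriv (2 * n) (invFourierPos g)
      = invFourierPos fun ξ => (-psiSymbol 2 0 ξ) ^ n * g ξ := by
  simp only [hg.iteratedDeriv_invFourierPos, pow_mul, psiSymbol_two_zero, mul_pow, neg_sq,
    Complex.I_sq, neg_one_mul]

theorem isExpSecondDeriv_invFourierPos (hg : RapidDecaySymbol g) {b K : ℝ}
    (hK : ∀ ξ, ‖g ξ‖ ≤ K * Real.exp (-(b * (psiSymbol 2 0 ξ).re))) (hb : 1 ≤ b) :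
    IsExpSecondDeriv (invFourierPos g)
      (invFourierPos fun ξ => Complex.exp (-psiSymbol 2 0 ξ) * g ξ) where
  smooth := hg.contDiff_invFourierPos
  integrable n := by
    rw [hg.iteratedDeriv_invFourierPos]
    exact (hg.mul (SlowGrowthSymbol.neg_I_mul.pow _)).integrable_invFourierPos
  tendsto := by
    simp only [hg.iteratedDeriv_two_mul_invFourierPos]
    simpa only [one_div, inv_mul_eq_div] using tendstoUniformly_exp_series one_lt_two (by simp) hg
      (norm_le_mul_exp_neg_abs_rpow one_lt_two hK (by simpa using hb))

theorem isContinuousDensity_invFourierPos (hg : RapidDecaySymbol g) {ν : Measure ℝ}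
    [IsFiniteMeasure ν] (h : ∀ ξ, charFun ν ξ = g ξ) : IsContinuousDensity ν (invFourierPos g) :=
  isContinuousDensity_of_charFun hg.continuous_invFourierPos hg.integrable_invFourierPos
    fun ξ => by rw [h, hg.fourierPos_invFourierPos]

theorem setIntegral_Iic_invFourierPos (hg : RapidDecaySymbol g) (x : ℝ) :
    ∫ z in Set.Iic x, invFourierPos (fun ξ => -Complex.I * ξ * g ξ) z = invFourierPos g x := by
  have integrable_deriv :=
    (hg.mul .neg_I_mul).integrable_invFourierPos.integrableOn (s := Set.Iic x)
  have tendsto_zero := tendsto_zero_of_hasDerivAt_of_integrableOn_Iic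
    (fun z _ => hg.hasDerivAt_invFourierPos z) integrable_deriv
    hg.integrable_invFourierPos.integrableOn
  rw [integral_Iic_of_hasDerivAt_of_tendsto' (fun z _ => hg.hasDerivAt_invFourierPos z)
    integrable_deriv tendsto_zero, sub_zero]

end RapidDecaySymbol

theorem fellerSymbol_mul_psiDeriv (α θ : ℝ) {ξ : ℝ} (hξ : ξ ≠ 0) :
    ((|ξ| ^ (-(α - 1)) : ℝ) : ℂ) *
        Complex.exp (-(Complex.I * ((Real.pi * (θ - 1) * Real.sign ξ / 2 : ℝ) : ℂ))) *
      psiDeriv α θ ξ = α * Complex.I := by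
  have abs_mul_sign : |ξ| * Real.sign ξ = ξ := by
    rcases hξ.lt_or_gt with h | h
    · rw [Real.sign_of_neg h, abs_of_neg h, neg_mul_neg, mul_one]
    · rw [Real.sign_of_pos h, abs_of_pos h, mul_one]
  have modulus : |ξ| ^ (-(α - 1)) * (α * |ξ| ^ (α - 2) * ξ) = α * Real.sign ξ := by
    have : |ξ| ^ (-(α - 1)) * |ξ| ^ (α - 2) * |ξ| = 1 := by
      rw [← Real.rpow_add (by positivity), ← Real.rpow_add_one (by positivity)]
      ring_nf
      exact Real.rpow_zero _
    linear_combination α * Real.sign ξ * this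
      - α * (|ξ| ^ (-(α - 1)) * |ξ| ^ (α - 2)) * abs_mul_sign
  have phase : Complex.exp (-(Complex.I * ((Real.pi * (θ - 1) * Real.sign ξ / 2 : ℝ) : ℂ))) *
      Complex.exp (Complex.I * ((Real.sign ξ * θ * Real.pi / 2 : ℝ) : ℂ))
      = Real.sign ξ * Complex.I := by
    have exponent : -(Complex.I * ((Real.pi * (θ - 1) * Real.sign ξ / 2 : ℝ) : ℂ)) +
        Complex.I * ((Real.sign ξ * θ * Real.pi / 2 : ℝ) : ℂ)
        = Real.sign ξ * (Real.pi / 2 * Complex.I) := by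
      push_cast
      ring
    rw [← Complex.exp_add, exponent]
    rcases hξ.lt_or_gt with h | h
    · simp [Real.sign_of_neg h, Complex.exp_neg, Complex.exp_pi_div_two_mul_I]
    · simp [Real.sign_of_pos h, Complex.exp_pi_div_two_mul_I]
  have sign_sq : (Real.sign ξ : ℂ) * Real.sign ξ = 1 := by
    rcases hξ.lt_or_gt with h | h <;> simp [Real.sign_of_neg, Real.sign_of_pos, h]
  rw [psiDeriv, mul_mul_mul_comm, phase, ← Complex.ofReal_mul, modulus]
  push_cast
  linear_combination α * Complex.I * sign_sq

/-- The density of `𝒮(a t + B(t))` for a process `𝒮` with characteristic exponent `ψ`. -/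
noncomputable def yuleDensity (ψ : ℝ → ℂ) (a rate t : ℝ) : ℝ → ℝ :=
  invFourierPos fun ξ => yuleMixture a rate t (ψ ξ)

section YuleDensity

variable {a rate t : ℝ} (hq : |1 - Real.exp (-(rate * t))| < 1) (hb : 0 < 1 + a * t)
include hq hb

namespace CoerciveSymbol

variable {ψ : ℝ → ℂ} (hψ : CoerciveSymbol ψ)
include hψ

theorem rapidDecay_yuleMixture : RapidDecaySymbol fun ξ => yuleMixture a rate t (ψ ξ) :=
  hψ.rapidDecay_geometricMixture hq hb

theorem rapidDecay_yuleMixtureDeriv :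
    RapidDecaySymbol fun ξ => yuleMixtureDeriv a rate t (ψ ξ) :=
  hψ.rapidDecay_geometricMixtureDeriv hq hb

theorem hasDerivAt_yuleDensity {c : ℝ} (hc : c ≠ 0) (x : ℝ) :
    HasDerivAt (fun s => yuleDensity ψ a rate s x)
      (a * (invFourierPos (fun ξ => -ψ ξ * yuleMixture a rate t (ψ ξ)) x
          + rate * t * (yuleDensity ψ a rate t x
            - invFourierPos (fun ξ => Complex.exp (-ψ ξ) * yuleMixture a rate t (ψ ξ)) x))
        + rate / c * (invFourierPos (fun ξ => c * yuleMixtureDeriv a rate t (ψ ξ)) x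
          - invFourierPos
            (fun ξ => Complex.exp (-ψ ξ) * (c * yuleMixtureDeriv a rate t (ψ ξ))) x)) t := by
  refine (hψ.hasDerivAt_invFourierPos_yuleMixture hq hb x).congr_deriv ?_
  have decay := hψ.rapidDecay_yuleMixture hq hb
  have decay_deriv := hψ.rapidDecay_yuleMixtureDeriv hq hb
  have shift {g : ℝ → ℂ} (hg : RapidDecaySymbol g) := (hg.mul hψ.slowGrowth_cexp_neg).integrable
  have sub_shift {g : ℝ → ℂ} (hg : RapidDecaySymbol g) :
      Integrable fun ξ => g ξ - Complex.exp (-ψ ξ) * g ξ := hg.integrable.sub (shift hg)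
  have neg_mul_integrable := (decay.mul hψ.neg).integrable
  simp only [yuleMixtureTimeDeriv_eq hq (hψ.re_nonneg _), mul_left_comm _ (c : ℂ),
    ← Complex.ofReal_mul, invFourierPos_const_mul]
  rw [invFourierPos_add
      ((neg_mul_integrable.fun_add ((sub_shift decay).const_mul _)).const_mul _)
      ((sub_shift decay_deriv).const_mul _),
    invFourierPos_const_mul, invFourierPos_const_mul,
    invFourierPos_add neg_mul_integrable ((sub_shift decay).const_mul _), invFourierPos_const_mul,
    invFourierPos_sub decay.integrable (shift decay),
    invFourierPos_sub decay_deriv.integrable (shift decay_deriv), yuleDensity]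
  field_simp

end CoerciveSymbol

end YuleDensity

section PsiSymbol

variable {α θ a rate t : ℝ} (hα : 1 < α)
include hα

theorem hasDerivAt_yuleMixture_psiSymbol (hq : |1 - Real.exp (-(rate * t))| < 1)
    (hθ : 0 < Real.cos (θ * Real.pi / 2)) (ξ : ℝ) :
    HasDerivAt (fun ξ => yuleMixture a rate t (psiSymbol α θ ξ))
      (yuleMixtureDeriv a rate t (psiSymbol α θ ξ) * psiDeriv α θ ξ) ξ :=
  (hasDerivAt_geometricMixture hq ((coerciveSymbol_psiSymbol hα hθ).re_nonneg ξ)).comp ξ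
    (hasDerivAt_psiSymbol hα θ ξ)

variable (hθ : 0 < Real.cos (θ * Real.pi / 2)) (hq : |1 - Real.exp (-(rate * t))| < 1)
  (hb : 0 < 1 + a * t)
include hθ hq hb

theorem fourierPos_mul_yuleDensity
    (hi : Integrable fun x => x * yuleDensity (psiSymbol α θ) a rate t x) (ξ : ℝ) :
    fourierPos (fun x => x * yuleDensity (psiSymbol α θ) a rate t x) ξ
      = -Complex.I * (yuleMixtureDeriv a rate t (psiSymbol α θ ξ) * psiDeriv α θ ξ) := by
  have decay := (coerciveSymbol_psiSymbol hα hθ).rapidDecay_yuleMixture hq hb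
  have deriv_transform := hasDerivAt_fourierPos decay.integrable_invFourierPos hi ξ
  rw [funext decay.fourierPos_invFourierPos] at deriv_transform
  have deriv_eq := deriv_transform.unique (hasDerivAt_yuleMixture_psiSymbol hα hq hθ ξ)
  rw [← deriv_eq, ← mul_assoc, neg_mul, Complex.I_mul_I, neg_neg, one_mul]
  rfl

theorem isFellerIntegral_mul_yuleDensity
    (hi : Integrable fun x => x * yuleDensity (psiSymbol α θ) a rate t x) :
    IsFellerIntegral (α - 1) (θ - 1) (fun x => x * yuleDensity (psiSymbol α θ) a rate t x)
      (invFourierPos fun ξ => α * yuleMixtureDeriv a rate t (psiSymbol α θ ξ)) := by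
  have decay := ((coerciveSymbol_psiSymbol hα hθ).rapidDecay_yuleMixtureDeriv hq hb).mul (.const α)
  refine ⟨hi, decay.integrable_invFourierPos, decay.continuous_invFourierPos, fun ξ hξ => ?_⟩
  rw [decay.fourierPos_invFourierPos, fourierPos_mul_yuleDensity hα hθ hq hb hi]
  linear_combination
    Complex.I * yuleMixtureDeriv a rate t (psiSymbol α θ ξ) * fellerSymbol_mul_psiDeriv α θ hξ
      + α * yuleMixtureDeriv a rate t (psiSymbol α θ ξ) * Complex.I_mul_I

theorem integrable_mul_yuleDensity {ν : Measure ℝ} [IsProbabilityMeasure ν]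
    (hν : ∀ ξ, charFun ν ξ = yuleMixture a rate t (psiSymbol α θ ξ)) :
    Integrable fun x => x * yuleDensity (psiSymbol α θ) a rate t x := by
  have hψ := coerciveSymbol_psiSymbol hα hθ
  have density := (hψ.rapidDecay_yuleMixture hq hb).isContinuousDensity_invFourierPos hν
  have one_sub_charFun_le (ξ : ℝ) := norm_one_sub_geometricMixture_le hb.le hq (hψ.re_nonneg ξ)
  simp only [norm_psiSymbol] at one_sub_charFun_le
  exact density.integrable_mul (integrable_id_of_charFun hα fun ξ => by
    rw [hν]
    exact one_sub_charFun_le ξ)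

end PsiSymbol

section Gaussian

variable {a rate t : ℝ} (hq : |1 - Real.exp (-(rate * t))| < 1) (hb : 0 < 1 + a * t)
include hq hb

theorem mul_yuleDensity_psiSymbol_two (x : ℝ) :
    x * yuleDensity (psiSymbol 2 0) a rate t x = invFourierPos (fun ξ =>
      -Complex.I * ξ * (((2 : ℝ) : ℂ) * yuleMixtureDeriv a rate t (psiSymbol 2 0 ξ))) x := by
  rw [yuleDensity, (coerciveSymbol_psiSymbol_two.rapidDecay_yuleMixture hq hb).mul_invFourierPos]
  congr 1 with ξ
  rw [(hasDerivAt_yuleMixture_psiSymbol one_lt_two hq (by simp) ξ).deriv, psiDeriv]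
  simp only [sub_self, Real.rpow_zero, mul_one, mul_zero, zero_mul, zero_div, Complex.ofReal_zero,
    Complex.exp_zero, Complex.ofReal_mul]
  ring

theorem integrable_mul_yuleDensity_psiSymbol_two :
    Integrable fun x => x * yuleDensity (psiSymbol 2 0) a rate t x := by
  have decay_deriv := coerciveSymbol_psiSymbol_two.rapidDecay_yuleMixtureDeriv hq hb
  rw [funext (mul_yuleDensity_psiSymbol_two hq hb)]
  exact ((decay_deriv.mul (.const 2)).mul .neg_I_mul).integrable_invFourierPos

theorem setIntegral_Iic_mul_yuleDensity_psiSymbol_two (x : ℝ) :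
    ∫ z in Set.Iic x, z * yuleDensity (psiSymbol 2 0) a rate t z = invFourierPos (fun ξ =>
      ((2 : ℝ) : ℂ) * yuleMixtureDeriv a rate t (psiSymbol 2 0 ξ)) x := by
  have decay_deriv := coerciveSymbol_psiSymbol_two.rapidDecay_yuleMixtureDeriv hq hb
  simp_rw [mul_yuleDensity_psiSymbol_two hq hb]
  exact (decay_deriv.mul (.const 2)).setIntegral_Iic_invFourierPos x

end Gaussian

section Evolution

variable {a rate t : ℝ} (hq : |1 - Real.exp (-(rate * t))| < 1)
include hq

theorem norm_mul_yuleMixtureDeriv_le (c : ℝ) {w : ℂ} (hb : 0 ≤ 1 + a * t) (hw : 0 ≤ w.re) :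
    ‖(c : ℂ) * yuleMixtureDeriv a rate t w‖
      ≤ |c| * ((1 + a * t + (1 - |1 - Real.exp (-(rate * t))|)⁻¹)
          * (2 / (1 - |1 - Real.exp (-(rate * t))|))) * Real.exp (-((1 + a * t) * w.re)) := by
  rw [norm_mul, Complex.norm_real, Real.norm_eq_abs, mul_assoc]
  gcongr
  exact norm_geometricMixtureDeriv_le hb hq hw

theorem exists_rieszFeller_evolution {α θ : ℝ} (hα : 1 < α) (hθ : 0 < Real.cos (θ * Real.pi / 2))
    (hb : 0 < 1 + a * t) (hi : Integrable fun x => x * yuleDensity (psiSymbol α θ) a rate t x) :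
    ∃ Du Ou J OJ : ℝ → ℝ,
      IsRieszFeller α θ (yuleDensity (psiSymbol α θ) a rate t) Du ∧
      IsFractionalShift α θ 1 (yuleDensity (psiSymbol α θ) a rate t) Ou ∧
      IsFellerIntegral (α - 1) (θ - 1) (fun x => x * yuleDensity (psiSymbol α θ) a rate t x) J ∧
      IsFractionalShift α θ 1 J OJ ∧
      (1 ≤ (1 + a * t) * Real.cos (θ * Real.pi / 2) →
        IsUniformFractionalShift α θ 1 (yuleDensity (psiSymbol α θ) a rate t) Ou ∧
        IsUniformFractionalShift α θ 1 J OJ) ∧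
      ∀ x : ℝ, HasDerivAt (fun s => yuleDensity (psiSymbol α θ) a rate s x)
        (a * (Du x + rate * t * (yuleDensity (psiSymbol α θ) a rate t x - Ou x))
          + rate / α * (J x - OJ x)) t := by
  have hψ := coerciveSymbol_psiSymbol hα hθ
  have decay := hψ.rapidDecay_yuleMixture hq hb
  have decay_deriv := (hψ.rapidDecay_yuleMixtureDeriv hq hb).mul (.const α)
  exact ⟨_, _, _, _, decay.isRieszFeller_invFourierPos hα hθ,
    decay.isFractionalShift_invFourierPos hα hθ,
    isFellerIntegral_mul_yuleDensity hα hθ hq hb hi,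
    decay_deriv.isFractionalShift_invFourierPos hα hθ,
    fun hcos => ⟨decay.isUniformFractionalShift_invFourierPos hα hθ
        (fun ξ => norm_geometricMixture_le hq (hψ.re_nonneg ξ)) hcos,
      decay_deriv.isUniformFractionalShift_invFourierPos hα hθ
        (fun ξ => norm_mul_yuleMixtureDeriv_le hq α hb.le (hψ.re_nonneg ξ)) hcos⟩,
    hψ.hasDerivAt_yuleDensity hq hb (by positivity)⟩

theorem exists_expSecondDeriv_evolution (hb : 1 ≤ 1 + a * t) :
    ∃ Eu EW : ℝ → ℝ,
      IsExpSecondDeriv (yuleDensity (psiSymbol 2 0) a rate t) Eu ∧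
      Integrable (fun z => z * yuleDensity (psiSymbol 2 0) a rate t z) ∧
      IsExpSecondDeriv
        (fun x => ∫ z in Set.Iic x, z * yuleDensity (psiSymbol 2 0) a rate t z) EW ∧
      ∀ x : ℝ, HasDerivAt (fun s => yuleDensity (psiSymbol 2 0) a rate s x)
        (a * (iteratedDeriv 2 (yuleDensity (psiSymbol 2 0) a rate t) x
            + rate * t * (yuleDensity (psiSymbol 2 0) a rate t x - Eu x))
          + rate / 2 * ((∫ z in Set.Iic x, z * yuleDensity (psiSymbol 2 0) a rate t z) - EW x))
        t := by
  have hψ := coerciveSymbol_psiSymbol_two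
  have b_pos : 0 < 1 + a * t := by linarith
  have decay := hψ.rapidDecay_yuleMixture hq b_pos
  have decay_deriv := (hψ.rapidDecay_yuleMixtureDeriv hq b_pos).mul (.const 2)
  have iteratedDeriv_two : iteratedDeriv 2 (yuleDensity (psiSymbol 2 0) a rate t)
      = invFourierPos fun ξ => -psiSymbol 2 0 ξ * yuleMixture a rate t (psiSymbol 2 0 ξ) := by
    simpa only [mul_one, pow_one, yuleDensity] using decay.iteratedDeriv_two_mul_invFourierPos 1
  simp only [iteratedDeriv_two, setIntegral_Iic_mul_yuleDensity_psiSymbol_two hq b_pos]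
  exact ⟨_, _, decay.isExpSecondDeriv_invFourierPos
      (fun ξ => norm_geometricMixture_le hq (hψ.re_nonneg ξ)) hb,
    integrable_mul_yuleDensity_psiSymbol_two hq b_pos,
    decay_deriv.isExpSecondDeriv_invFourierPos
      (fun ξ => norm_mul_yuleMixtureDeriv_le hq 2 b_pos.le (hψ.re_nonneg ξ)) hb,
    hψ.hasDerivAt_yuleDensity hq b_pos two_ne_zero⟩

end Evolution

section Law

variable {Ω : Type*} [MeasurableSpace Ω] {μ : Measure Ω} [IsProbabilityMeasure μ] {ψ : ℝ → ℂ}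
  {S : ℝ≥0 → Ω → ℝ}

theorem CoerciveSymbol.isContinuousDensity_yuleDensity (hψ : CoerciveSymbol ψ) {rate : ℝ}
    {B : ℝ≥0 → Ω → ℕ} (hS : HasCharExponent ψ S μ) (hB : HasYuleMarginals rate B μ)
    (hrate : 0 ≤ rate) (hSB : ∀ s t, IndepFun (S s) (B t) μ) (a t : ℝ≥0) :
    IsContinuousDensity (μ.map fun ω => S (a * t + (B t ω : ℝ≥0)) ω) (yuleDensity ψ a rate t) :=
  (hψ.rapidDecay_yuleMixture (abs_one_sub_exp_neg_lt_one (by positivity)) (by positivity)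
    ).isContinuousDensity_invFourierPos
      (charFun_subordinated_yule hS hψ.re_nonneg hB hrate hSB a t)

theorem CoerciveSymbol.isContinuousDensity_yuleDensity_zero (hψ : CoerciveSymbol ψ)
    (hS : HasCharExponent ψ S μ) (a rate : ℝ) :
    IsContinuousDensity (μ.map (S 1)) (yuleDensity ψ a rate 0) :=
  (hψ.rapidDecay_yuleMixture (by simp) (by simp)).isContinuousDensity_invFourierPos fun ξ => by
    simp [hS.charFun_map, yuleMixture, geometricMixture]

theorem isContinuousDensity_gaussianReal (m : ℝ) {v : ℝ≥0} (hv : v ≠ 0) :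
    IsContinuousDensity (gaussianReal m v) (gaussianPDFReal m v) where
  continuous := by
    unfold gaussianPDFReal
    fun_prop
  nonneg := gaussianPDFReal_nonneg m v
  eq_withDensity := gaussianReal_of_var_ne_zero m hv

theorem HasCharExponent.map_eq_gaussianReal (hS : HasCharExponent (psiSymbol 2 0) S μ) (t : ℝ≥0) :
    μ.map (S t) = gaussianReal 0 (2 * t) := by
  have := Measure.isProbabilityMeasure_map (μ := μ) (hS.measurable t).aemeasurable
  refine Measure.ext_of_charFun (funext fun ξ => ?_)
  rw [hS.charFun_map, charFun_gaussianReal, psiSymbol_two_zero]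
  congr 1
  push_cast
  ring

theorem yuleDensity_psiSymbol_two_zero (hS : HasCharExponent (psiSymbol 2 0) S μ) (a rate : ℝ) :
    yuleDensity (psiSymbol 2 0) a rate 0 = gaussianPDFReal 0 2 := by
  have density := coerciveSymbol_psiSymbol_two.isContinuousDensity_yuleDensity_zero hS a rate
  rw [hS.map_eq_gaussianReal, mul_one] at density
  exact density.unique (isContinuousDensity_gaussianReal 0 two_ne_zero)

end Law

theorem cos_two_sub_mul_pi_div_two_pos {α : ℝ} (h1 : 1 < α) (h3 : α < 3) :
    0 < Real.cos ((2 - α) * Real.pi / 2) :=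
  Real.cos_pos_of_mem_Ioo ⟨by nlinarith [Real.pi_pos], by nlinarith [Real.pi_pos]⟩

theorem theorem18_general {Ω : Type*} [MeasurableSpace Ω] (μ : Measure Ω) [IsProbabilityMeasure μ]
    (a : ℝ≥0) (rate : ℝ) (hrate : 0 ≤ rate)
    (S : ℝ≥0 → Ω → ℝ) (B : ℝ≥0 → Ω → ℕ) (hB : HasYuleMarginals rate B μ)
    (hSB : ∀ s t, IndepFun (S s) (B t) μ) :
    (∀ α θ : ℝ, 1 < α → 0 < Real.cos (θ * Real.pi / 2) → HasCharExponent (psiSymbol α θ) S μ →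
      ∃ u : ℝ → ℝ → ℝ,
        (∀ t : ℝ≥0, IsContinuousDensity (μ.map (fun ω => S (a * t + (B t ω : ℝ≥0)) ω)) (u t)) ∧
        IsContinuousDensity (μ.map (S 1)) (u 0) ∧
        ∀ t : ℝ, 0 ≤ t →
          ∃ Du Ou J OJ : ℝ → ℝ,
            IsRieszFeller α θ (u t) Du ∧
            IsFractionalShift α θ 1 (u t) Ou ∧
            IsFellerIntegral (α - 1) (θ - 1) (fun x => x * u t x) J ∧
            IsFractionalShift α θ 1 J OJ ∧
            (1 ≤ (1 + a * t) * Real.cos (θ * Real.pi / 2) →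
              IsUniformFractionalShift α θ 1 (u t) Ou ∧
              IsUniformFractionalShift α θ 1 J OJ) ∧
            ∀ x : ℝ, HasDerivWithinAt (fun s : ℝ => u s x)
              (a * (Du x + rate * t * (u t x - Ou x)) + rate / α * (J x - OJ x))
              (Set.Ici 0) t) ∧
    (HasCharExponent (psiSymbol 2 0) S μ →
      ∃ u : ℝ → ℝ → ℝ,
        (∀ t : ℝ≥0, IsContinuousDensity (μ.map (fun ω => S (a * t + (B t ω : ℝ≥0)) ω)) (u t)) ∧
        (∀ x : ℝ, u 0 x = gaussianPDFReal 0 2 x) ∧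
        ∀ t : ℝ, 0 ≤ t →
          ∃ Eu EW : ℝ → ℝ,
            IsExpSecondDeriv (u t) Eu ∧
            Integrable (fun z => z * u t z) ∧
            IsExpSecondDeriv (fun x => ∫ z in Set.Iic x, z * u t z) EW ∧
            ∀ x : ℝ, HasDerivWithinAt (fun s : ℝ => u s x)
              (a * (iteratedDeriv 2 (u t) x + rate * t * (u t x - Eu x))
                + rate / 2 * ((∫ z in Set.Iic x, z * u t z) - EW x))
              (Set.Ici 0) t) := by
  have hq {t : ℝ} (ht : 0 ≤ t) := abs_one_sub_exp_neg_lt_one (mul_nonneg hrate ht)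
  refine ⟨fun α θ hα hθ hS => ?_, fun hS => ?_⟩
  · have hψ := coerciveSymbol_psiSymbol hα hθ
    refine ⟨yuleDensity (psiSymbol α θ) a rate,
      hψ.isContinuousDensity_yuleDensity hS hB hrate hSB a,
      hψ.isContinuousDensity_yuleDensity_zero hS a rate, fun t ht => ?_⟩
    have hb : 0 < 1 + a * t := by positivity
    lift t to ℝ≥0 using ht
    have law := charFun_subordinated_yule hS hψ.re_nonneg hB hrate hSB a t
    have := Measure.isProbabilityMeasure_map (μ := μ)
      (measurable_randomTime (fun n : ℕ => hS.measurable (a * t + n))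
        (hB.measurable t)).aemeasurable
    obtain ⟨Du, Ou, J, OJ, hDu, hOu, hJ, hOJ, huniform, hderiv⟩ :=
      exists_rieszFeller_evolution (hq t.coe_nonneg) hα hθ hb
        (integrable_mul_yuleDensity hα hθ (hq t.coe_nonneg) hb law)
    exact ⟨Du, Ou, J, OJ, hDu, hOu, hJ, hOJ, huniform, fun x => (hderiv x).hasDerivWithinAt⟩
  · refine ⟨yuleDensity (psiSymbol 2 0) a rate,
      coerciveSymbol_psiSymbol_two.isContinuousDensity_yuleDensity hS hB hrate hSB a,
      congrFun (yuleDensity_psiSymbol_two_zero hS a rate), fun t ht => ?_⟩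
    obtain ⟨Eu, EW, hEu, integrable_mul, hEW, hderiv⟩ := exists_expSecondDeriv_evolution (hq ht)
      (le_add_of_nonneg_right (mul_nonneg a.coe_nonneg ht))
    exact ⟨Eu, EW, hEu, integrable_mul, hEW, fun x => (hderiv x).hasDerivWithinAt⟩

theorem theorem18 {Ω : Type*} [MeasurableSpace Ω] (μ : Measure Ω) [IsProbabilityMeasure μ]
    (a : ℝ≥0) (rate : ℝ) (hrate : 0 < rate)
    (S : ℝ≥0 → Ω → ℝ) (B : ℝ≥0 → Ω → ℕ) (hB : IsYuleProcess rate B μ)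
    (hSB : IndepFun (fun ω (s : ℝ≥0) => S s ω) (fun ω (t : ℝ≥0) => B t ω) μ) :
    (∀ α : ℝ, 1 < α → α < 2 → IsStableProcess α (2 - α) S μ →
      ∃ u : ℝ → ℝ → ℝ,
        (∀ t : ℝ≥0, IsContinuousDensity (μ.map (fun ω => S (a * t + (B t ω : ℝ≥0)) ω)) (u t)) ∧
        IsContinuousDensity (μ.map (S 1)) (u 0) ∧
        ∀ t : ℝ, 0 ≤ t →
          ∃ Du Ou J OJ : ℝ → ℝ,
            IsRieszFeller α (2 - α) (u t) Du ∧
            IsFractionalShift α (2 - α) 1 (u t) Ou ∧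
            IsFellerIntegral (α - 1) (1 - α) (fun x => x * u t x) J ∧
            IsFractionalShift α (2 - α) 1 J OJ ∧
            (1 ≤ (1 + a * t) * Real.cos ((2 - α) * Real.pi / 2) →
              IsUniformFractionalShift α (2 - α) 1 (u t) Ou ∧
              IsUniformFractionalShift α (2 - α) 1 J OJ) ∧
            ∀ x : ℝ, HasDerivWithinAt (fun s : ℝ => u s x)
              (a * (Du x + rate * t * (u t x - Ou x)) + rate / α * (J x - OJ x))
              (Set.Ici 0) t) ∧
    (IsStableProcess 2 0 S μ →
      ∃ u : ℝ → ℝ → ℝ,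
        (∀ t : ℝ≥0, IsContinuousDensity (μ.map (fun ω => S (a * t + (B t ω : ℝ≥0)) ω)) (u t)) ∧
        (∀ x : ℝ, u 0 x = gaussianPDFReal 0 2 x) ∧
        ∀ t : ℝ, 0 ≤ t →
          ∃ Eu EW : ℝ → ℝ,
            IsExpSecondDeriv (u t) Eu ∧
            Integrable (fun z => z * u t z) ∧
            IsExpSecondDeriv (fun x => ∫ z in Set.Iic x, z * u t z) EW ∧
            ∀ x : ℝ, HasDerivWithinAt (fun s : ℝ => u s x)
              (a * (iteratedDeriv 2 (u t) x + rate * t * (u t x - Eu x))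
                + rate / 2 * ((∫ z in Set.Iic x, z * u t z) - EW x))
              (Set.Ici 0) t) := by
  have general := theorem18_general μ a rate hrate.le S B (hB.hasYuleMarginals hrate)
    fun s t => hSB.comp (measurable_pi_apply s) (measurable_pi_apply t)
  refine ⟨fun α h1 h2 hS => ?_, fun hS => general.2 hS.hasCharExponent⟩
  rw [show 1 - α = 2 - α - 1 by ring]
  exact general.1 α (2 - α) h1 (cos_two_sub_mul_pi_div_two_pos h1 (by linarith)) hS.hasCharExponent
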